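/- Let $P$ be a Markov transition kernel on a measurable space $(S,\mathcal B)$. Suppose that there are $C\in\mathcal B$, $0<\tilde\beta<1$ and a probability measure $\nu$ on $(S,\mathcal B)$ with $P(x,A)\ge\tilde\beta\,\nu(A)$ for all $x\in C$, $A\in\mathcal B$, and fix $a\in C$. Suppose that the chain is geometrically ergodic with invariant probability measure $\pi$: $\pi P=\pi$, and for each $x\in S$ there is $\gamma\in(0,1)$ with $\gamma^{-n}\|P^n(x,\cdot)-\pi\|_{TV}\to0$ as $n\to\infty$. Let $V:S\to[0,\infty)$ be measurable. The split chain $(X_n,Y_n)_{n\ge0}$ is the Markov chain on $S\times\{0,1\}$ in which, given $(X_n,Y_n)$, the variable $X_{n+1}$ has law $\nu$ if $Y_n=1$ and law $\dfrac{P(X_n,\cdot)-\tilde\beta\mathbf 1_C(X_n)\nu}{1-\tilde\beta\mathbf 1_C(X_n)}$ if $Y_n=0$, and then $Y_{n+1}=1$ with probability $\tilde\beta\mathbf 1_C(X_{n+1})$ and $Y_{n+1}=0$ otherwise. Let $\bar{\mathbf P}^{x,i},\bar{\mathbf E}^{x,i}$ be its law and expectation when started at $X_0=x$, $Y_0=i$,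 and put $\bar{\mathbf E}^x=[1-\tilde\beta\mathbf 1_C(x)]\bar{\mathbf E}^{x,0}+\tilde\beta\mathbf 1_C(x)\bar{\mathbf E}^{x,1}$. Let $T=\inf\{n\ge1:Y_n=1\}\in\{1,2,\dots\}\cup\{\infty\}$ and, with values in $[0,\infty]$, $$\bar G(r,x)=\bar{\mathbf E}^x(r^T),\qquad \bar H(r,x)=\bar{\mathbf E}^x\Big(\sum_{n=1}^T r^nV(X_n)\Big),\qquad \bar H(r,a,1)=\bar{\mathbf E}^{a,1}\Big(\sum_{n=1}^T r^nV(X_n)\Big),$$ and let $\bar u_n=\bar{\mathbf P}^{a,1}(Y_n=1)$ for $n\ge0$. Proposition 4.3. The limit $\bar u_\infty=\lim_{n\to\infty}\bar u_n$ exists. Moreover, let $g:S\to\mathbf R$ be measurable with $\|g\|_V\le1$, that is, $|g(y)|\le V(y)$ for all $y\in S$. Then for every $x\in S$ $$\sup_{|z|\le r}\Big|\sum_{n=1}^\infty\Big(P^ng(x)-\int g\,d\pi\Big)z^n\Big|\le \bar H(r,x)+\bar G(r,x)\,\bar H(r,a,1)\sup_{|z|\le r}\Big|\sum_{n=0}^\infty(\bar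 u_n-\bar u_\infty)z^n\Big|+\bar H(r,a,1)\frac{\bar G(r,x)-1}{r-1}+\frac{\bar H(r,a,1)-r\bar H(1,a,1)}{r-1}$$ for all $r>1$ for which the right-hand side is finite. For such $r$ and $x$ the integrals $\int g\,d\pi$ and $P^ng(x)$, $n\ge0$, converge absolutely and the series on the left converges for all complex $z$ with $|z|\le r$. Here $z$ ranges over the complex numbers, a supremum over $|z|\le r$ is $+\infty$ if the series diverges for some such $z$, and $0\cdot\infty=0$. -/

import Mathlib

open MeasureTheory ProbabilityTheory Filter Topology
open scoped ENNReal NNReal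

namespace SplitChain

noncomputable section

/-! ### Geometric ergodicity -/

/-- The total variation norm `‖μ - π‖_TV`, normalised as
`sup {|∫ g dμ - ∫ g dπ| : g measurable, |g| ≤ 1}`. -/
def tvNorm {S : Type*} [MeasurableSpace S] (μ π : Measure S) : ℝ≥0∞ :=
  ⨆ (g : S → ℝ) (_ : Measurable g) (_ : ∀ y, |g y| ≤ 1), ‖∫ y, g y ∂μ - ∫ y, g y ∂π‖ₑ

/-- The chain with transition kernel `P` is geometrically ergodic with invariant law `π`:
`π` is invariant and for each `x` there is `γ < 1` with `γ⁻ⁿ ‖Pⁿ(x, ·) - π‖_TV → 0`. -/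
structure IsGeometricallyErgodic {S : Type*} [MeasurableSpace S]
    (P : Kernel S S) (π : Measure S) : Prop where
  invariant : P.Invariant π
  tendsto : ∀ x, ∃ γ : ℝ, 0 < γ ∧ γ < 1 ∧
    Tendsto (fun n : ℕ => ENNReal.ofReal ((γ ^ n)⁻¹) * tvNorm ((P ^ n) x) π) atTop (𝓝 0)

/-! ### The minorization condition and the split chain -/

/-- The minorization condition `P(x, A) ≥ β ν(A)` for all `x ∈ C` and all measurable `A`,
where `C` is measurable and `0 < β < 1`. -/
structure IsMinorized {S : Type*} [MeasurableSpace S]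
    (P : Kernel S S) (C : Set S) (β : ℝ≥0) (ν : Measure S) : Prop where
  measurableSet : MeasurableSet C
  pos : 0 < β
  lt_one : β < 1
  le : ∀ x ∈ C, ∀ A, MeasurableSet A → (β : ℝ≥0∞) * ν A ≤ P x A

/-- The probability `β 1_C(x)` that `Y_n = 1`, given `X_n = x`. -/
def splitProb {S : Type*} (C : Set S) (β : ℝ≥0) : S → ℝ≥0∞ :=
  C.indicator (fun _ => (β : ℝ≥0∞))

section Construction

variable {S : Type*} [MeasurableSpace S] {P : Kernel S S} {C : Set S} {β : ℝ≥0} {ν : Measure S}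

theorem measurable_splitProb (h : IsMinorized P C β ν) : Measurable (splitProb C β) :=
  measurable_const.indicator h.measurableSet

theorem splitProb_lt_one (h : IsMinorized P C β ν) (x : S) : splitProb C β x < 1 := by
  unfold splitProb
  by_cases hx : x ∈ C
  · simpa [hx] using h.lt_one
  · simp [hx]

theorem splitProb_smul_le (h : IsMinorized P C β ν) (x : S) : splitProb C β x • ν ≤ P x := by
  refine Measure.le_iff.2 fun A hA => ?_
  by_cases hx : x ∈ C
  · simpa [splitProb, hx] using h.le x hx A hA
  · simp [splitProb, hx]

theorem residual_apply [IsProbabilityMeasure ν] (h : IsMinorized P C β ν) (x : S) {A : Set S}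
    (hA : MeasurableSet A) :
    ((1 - splitProb C β x)⁻¹ • (P x - splitProb C β x • ν)) A
      = (1 - splitProb C β x)⁻¹ * (P x A - splitProb C β x * ν A) := by
  have : IsFiniteMeasure (splitProb C β x • ν) := by
    refine ⟨?_⟩
    simpa using (splitProb_lt_one h x).trans ENNReal.one_lt_top
  rw [Measure.smul_apply, Measure.sub_apply hA (splitProb_smul_le h x)]
  simp

/-- The residual kernel `(P(x, ·) - β 1_C(x) ν) / (1 - β 1_C(x))`: the law of `X_{n+1}` given
`X_n = x` and `Y_n = 0`. -/
def residualKernel [IsProbabilityMeasure ν] (h : IsMinorized P C β ν) : Kernel S S where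
  toFun x := (1 - splitProb C β x)⁻¹ • (P x - splitProb C β x • ν)
  measurable' := by
    refine Measure.measurable_of_measurable_coe _ fun A hA => ?_
    simp_rw [residual_apply h _ hA]
    exact ((measurable_splitProb h).const_sub 1).inv.mul
      ((P.measurable_coe hA).sub ((measurable_splitProb h).mul_const _))

instance [IsMarkovKernel P] [IsProbabilityMeasure ν] (h : IsMinorized P C β ν) :
    IsMarkovKernel (residualKernel h) := by
  refine ⟨fun x => ⟨?_⟩⟩
  have hlt := splitProb_lt_one h x
  change ((1 - splitProb C β x)⁻¹ • (P x - splitProb C β x • ν)) Set.univ = 1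
  rw [residual_apply h x MeasurableSet.univ]
  simp only [measure_univ, mul_one]
  exact ENNReal.inv_mul_cancel (tsub_pos_of_lt hlt).ne' (ENNReal.sub_ne_top ENNReal.one_ne_top)

/-- Given `X_n = x`, the law of `(X_n, Y_n)`: `X_n = x` and `Y_n = 1` with probability
`β 1_C(x)`. The two values `0, 1` of `Y_n` are `false, true`. -/
def splitKernel (h : IsMinorized P C β ν) : Kernel S (S × Bool) where
  toFun x := (1 - splitProb C β x) • Measure.dirac (x, false)
    + splitProb C β x • Measure.dirac (x, true)
  measurable' := by
    refine Measure.measurable_of_measurable_coe _ fun A hA => ?_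
    simp only [Measure.add_apply, Measure.smul_apply, smul_eq_mul, Measure.dirac_apply' _ hA]
    have h1 : ∀ i : Bool, Measurable fun x : S => A.indicator (1 : S × Bool → ℝ≥0∞) (x, i) :=
      fun i => (measurable_one.indicator hA).comp (measurable_id.prodMk measurable_const)
    exact (((measurable_splitProb h).const_sub 1).mul (h1 false)).add
      ((measurable_splitProb h).mul (h1 true))

instance (h : IsMinorized P C β ν) : IsMarkovKernel (splitKernel h) := by
  refine ⟨fun x => ⟨?_⟩⟩
  change ((1 - splitProb C β x) • Measure.dirac (x, false)
    + splitProb C β x • Measure.dirac (x, true)) Set.univ = 1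
  simpa using tsub_add_cancel_of_le (splitProb_lt_one h x).le

/-- The law of `X_{n+1}` given `(X_n, Y_n) = (x, i)`: it is `ν` if `i = 1` and the residual law
if `i = 0`. -/
def nextKernel [IsProbabilityMeasure ν] (h : IsMinorized P C β ν) : Kernel (S × Bool) S where
  toFun p := if p.2 = true then ν else residualKernel h p.1
  measurable' := Measurable.ite (measurable_snd (measurableSet_singleton true))
    measurable_const ((residualKernel h).measurable.comp measurable_fst)

instance [IsMarkovKernel P] [IsProbabilityMeasure ν] (h : IsMinorized P C β ν) :
    IsMarkovKernel (nextKernel h) := by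
  refine ⟨fun p => ?_⟩
  change IsProbabilityMeasure (if p.2 = true then ν else residualKernel h p.1)
  split_ifs <;> infer_instance

/-- The transition kernel of the split chain `(X_n, Y_n)` on `S × {0, 1}`: first `X_{n+1}` is
drawn given `(X_n, Y_n)`, then `Y_{n+1}` is drawn given `X_{n+1}`. -/
def chainKernel [IsProbabilityMeasure ν] (h : IsMinorized P C β ν) :
    Kernel (S × Bool) (S × Bool) :=
  splitKernel h ∘ₖ nextKernel h

instance [IsMarkovKernel P] [IsProbabilityMeasure ν] (h : IsMinorized P C β ν) :
    IsMarkovKernel (chainKernel h) := by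
  unfold chainKernel
  infer_instance

/-- The law on path space of the split chain started at `X_0 = x`, `Y_0 = i`, for `p = (x, i)`
(Ionescu-Tulcea). The coordinate process `ω ↦ ω n` is `(X_n, Y_n)`. -/
def pathLaw [IsMarkovKernel P] [IsProbabilityMeasure ν] (h : IsMinorized P C β ν)
    (p : S × Bool) : Measure (ℕ → S × Bool) :=
  Kernel.traj (X := fun _ => S × Bool)
    (fun n => (chainKernel h).comap
      (fun y : (i : Finset.Iic n) → S × Bool => y ⟨n, Finset.mem_Iic.2 le_rfl⟩)
      (measurable_pi_apply _)) 0 (fun _ => p)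

/-- The mixture `[1 - β 1_C(x)] P^{x,0} + β 1_C(x) P^{x,1}` of path laws. -/
def mixedPathLaw [IsMarkovKernel P] [IsProbabilityMeasure ν] (h : IsMinorized P C β ν)
    (x : S) : Measure (ℕ → S × Bool) :=
  (1 - splitProb C β x) • pathLaw h (x, false) + splitProb C β x • pathLaw h (x, true)

/-- The renewal sequence `u_n = P^{a,1}(Y_n = 1)`. -/
def renewalSeq [IsMarkovKernel P] [IsProbabilityMeasure ν] (h : IsMinorized P C β ν)
    (a : S) (n : ℕ) : ℝ :=
  (pathLaw h (a, true)).real {ω | (ω n).2 = true}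

end Construction

/-! ### The regeneration time and its generating functions -/

/-- The regeneration time `T = min {n ≥ 1 : Y_n = 1}`, which is `⊤` if there is no such `n`. -/
def regTime {S : Type*} (ω : ℕ → S × Bool) : ℕ∞ :=
  ⨅ (n : ℕ) (_ : 1 ≤ n ∧ (ω n).2 = true), (n : ℕ∞)

/-- `r ^ t` for an extended natural number `t`, with `r ^ ⊤ = lim r ^ n`. -/
def extPow (r : ℝ≥0) : ℕ∞ → ℝ≥0∞
  | (n : ℕ) => (r : ℝ≥0∞) ^ n
  | ⊤ => if r < 1 then 0 else if r = 1 then 1 else ⊤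

/-- `E(r ^ T)` under the path law `Q`. -/
def genG {S : Type*} [MeasurableSpace S] (Q : Measure (ℕ → S × Bool)) (r : ℝ≥0) : ℝ≥0∞ :=
  ∫⁻ ω, extPow r (regTime ω) ∂Q

open Classical in
/-- `E(∑_{n=1}^T r ^ n V(X_n))` under the path law `Q`. -/
def genH {S : Type*} [MeasurableSpace S] (Q : Measure (ℕ → S × Bool)) (V : S → ℝ≥0)
    (r : ℝ≥0) : ℝ≥0∞ :=
  ∫⁻ ω, ∑' n : ℕ,
    (if 1 ≤ n ∧ (n : ℕ∞) ≤ regTime ω then (r : ℝ≥0∞) ^ n * (V (ω n).1 : ℝ≥0∞) else 0) ∂Q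

/-! ### Suprema of power series -/

/-- `|∑_{n ≥ m} a_n|`, the series being understood as the limit of its partial sums; the value
is `⊤` if the series does not converge (infimum over an empty set). -/
def normSeries (m : ℕ) (a : ℕ → ℂ) : ℝ≥0∞ :=
  ⨅ (s : ℂ) (_ : Tendsto (fun N => ∑ n ∈ Finset.Ico m N, a n) atTop (𝓝 s)), ‖s‖ₑ

/-- `sup_{|z| ≤ r} |∑_{n ≥ m} c_n z ^ n|`. It is `⊤` as soon as the series diverges for some `z`
with `|z| ≤ r`. -/
def supSeries (m : ℕ) (c : ℕ → ℝ) (r : ℝ≥0) : ℝ≥0∞ :=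
  ⨆ (z : ℂ) (_ : ‖z‖ ≤ r), normSeries m (fun n => (c n : ℂ) * z ^ n)

/-- The bound, for the path laws `Qx` (chain started at `x`) and `Qa` (chain started at the atom)
and the centred renewal sequence `d`:
`H(r,x) + G(r,x) H(r,a,1) sup_{|z| ≤ r} |∑_{n ≥ 0} d_n z^n|
  + H(r,a,1) (G(r,x) - 1)/(r - 1) + (H(r,a,1) - r H(1,a,1))/(r - 1)`.
For `r > 1` and probability measures the truncated subtractions of `[0, ∞]` are the true ones
whenever the total is finite: `T ≥ 1` gives `G(r,x) ≥ r` and `H(r,a,1) ≥ r H(1,a,1)`, and then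
the third term is at least `H(r,a,1)`, so that `H(r,a,1)` is finite. -/
def regenBound {S : Type*} [MeasurableSpace S] (Qx Qa : Measure (ℕ → S × Bool)) (V : S → ℝ≥0)
    (d : ℕ → ℝ) (r : ℝ≥0) : ℝ≥0∞ :=
  genH Qx V r
    + genG Qx r * genH Qa V r * supSeries 0 d r
    + genH Qa V r * ((genG Qx r - 1) / ((r : ℝ≥0∞) - 1))
    + (genH Qa V r - (r : ℝ≥0∞) * genH Qa V 1) / ((r : ℝ≥0∞) - 1)

end

end SplitChain

/-! Started from the mixture of its two levels, the split chain has the `P`-chain as first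
coordinate. Moreover `{Y = 1}` is an atom: after a visit the next position has law `ν`, wherever the
visit took place. Cutting the path at the first and the last visit before time `n` gives, for
measurable `F ≥ 0` and `n ≥ 1`, `P^n F(x) = f_n + (a * u * t)_n` (`lintegral_kernel_pow_eq`). Here
`f_n` and `t_n` are the expectations of `F(X_n)` on `{n ≤ T}`, from `x` and from the atom; `a_n` is
the probability of `T = n` from `x`, and `u` is the renewal sequence.

Convergence in total variation yields `u_n → v = ∫ β 1_C dπ` (`tendsto_atomProb`). Comparing two
limits of `∫ P^n F dν` gives `π F = v ∑ t_j` when the sum is finite (`lintegral_invariant_eq`). With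
`b_n = 1 - ∑_{k ≤ n} a_k`, the probability of `T > n` from `x`, subtraction leads to `P^n F(x) - π F
= f_n + (a * t * (u - v))_n - v (t * b)_n - v ∑_{j > n} t_j` (`renewal_decomposition`).

The four terms produce the four summands of the bound. Indeed `0 ≤ v ≤ 1`, `∑ b_n r^n = (G - 1)/(r -
1)`, and the tails of the series for `H(1,a,1)` have generating function `(H(r,a,1) - r H(1,a,1))/(r
- 1)`. The series of `u - v` need not converge absolutely; convergence at each `z` is enough by
Mertens' theorem. A signed `g` is the difference of its positive and negative parts, and the
subtraction is made before absolute values are taken. -/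

namespace SplitChain

/-! ### Cauchy products -/

/-- The Cauchy product of two sequences. -/
def cauchyProd {R : Type*} [Semiring R] (a b : ℕ → R) (n : ℕ) : R :=
  ∑ p ∈ Finset.HasAntidiagonal.antidiagonal n, a p.1 * b p.2

theorem tsum_cauchyProd (a b : ℕ → ℝ≥0∞) :
    ∑' n, cauchyProd a b n = (∑' n, a n) * ∑' n, b n := by
  simp_rw [cauchyProd, ← ENNReal.tsum_mul_right, ← ENNReal.tsum_mul_left]
  rw [← ENNReal.tsum_prod (f := fun i j => a i * b j),
    ← (Finset.HasAntidiagonal.sigmaAntidiagonalEquivProd (A := ℕ)).tsum_eq, ENNReal.tsum_sigma']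
  refine tsum_congr fun n => ?_
  rw [tsum_fintype, ← Finset.sum_coe_sort]
  rfl

theorem cauchyProd_mul_pow {R : Type*} [CommSemiring R] (a b : ℕ → R) (z : R) (n : ℕ) :
    cauchyProd a b n * z ^ n = cauchyProd (fun k => a k * z ^ k) (fun k => b k * z ^ k) n := by
  simp only [cauchyProd, Finset.sum_mul]
  refine Finset.sum_congr rfl fun p hp => ?_
  rw [← Finset.HasAntidiagonal.mem_antidiagonal.1 hp, pow_add]
  ring

theorem enorm_cauchyProd_le (a b : ℕ → ℝ) (n : ℕ) :
    ‖cauchyProd a b n‖ₑ ≤ cauchyProd (fun k => ‖a k‖ₑ) (fun k => ‖b k‖ₑ) n := by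
  refine (enorm_sum_le _ _).trans (Finset.sum_le_sum fun p _ => ?_)
  rw [enorm_mul]

theorem ofReal_cauchyProd (a b : ℕ → ℝ) (n : ℕ) :
    ((cauchyProd a b n : ℝ) : ℂ) = cauchyProd (fun k => (a k : ℂ)) (fun k => (b k : ℂ)) n := by
  simp [cauchyProd]

theorem cauchyProd_assoc {R : Type*} [CommSemiring R] (a b c : ℕ → R) (n : ℕ) :
    cauchyProd (cauchyProd a b) c n = cauchyProd a (cauchyProd b c) n := by
  have key : ∀ f g : ℕ → R, ∀ m, cauchyProd f g m = PowerSeries.coeff m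
      (PowerSeries.mk f * PowerSeries.mk g) := by
    intro f g m
    simp [cauchyProd, PowerSeries.coeff_mul]
  have hmk : ∀ f g : ℕ → R, PowerSeries.mk (cauchyProd f g)
      = PowerSeries.mk f * PowerSeries.mk g := by
    intro f g
    ext m
    simp [key]
  rw [key, key, hmk, hmk, mul_assoc]

theorem cauchyProd_comm {R : Type*} [CommSemiring R] (a b : ℕ → R) (n : ℕ) :
    cauchyProd a b n = cauchyProd b a n := by
  unfold cauchyProd
  rw [← Finset.Nat.sum_antidiagonal_swap]
  exact Finset.sum_congr rfl fun p _ => mul_comm _ _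

theorem sum_range_cauchyProd {R : Type*} [CommSemiring R] (a b : ℕ → R) (N : ℕ) :
    ∑ n ∈ Finset.range N, cauchyProd a b n
      = ∑ k ∈ Finset.range N, a k * ∑ j ∈ Finset.range (N - k), b j := by
  induction N with
  | zero => simp
  | succ N ih =>
    rw [Finset.sum_range_succ, ih, cauchyProd, Finset.Nat.sum_antidiagonal_eq_sum_range_succ
      (fun i j => a i * b j), Finset.sum_range_succ (n := N), Finset.sum_range_succ (n := N),
      ← add_assoc, ← Finset.sum_add_distrib]
    congr 1
    · refine Finset.sum_congr rfl fun k hk => ?_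
      rw [Nat.succ_sub (Finset.mem_range.1 hk).le, Finset.sum_range_succ, mul_add]
    · simp

/-- Mertens' theorem on Cauchy products. -/
theorem tendsto_sum_cauchyProd {w d : ℕ → ℂ} (hw : Summable fun n => ‖w n‖) {s : ℂ}
    (hd : Tendsto (fun N => ∑ n ∈ Finset.range N, d n) atTop (𝓝 s)) :
    Tendsto (fun N => ∑ n ∈ Finset.range N, cauchyProd w d n) atTop (𝓝 ((∑' n, w n) * s)) := by
  -- Only `w` is absolutely summable. The partial sums of `d` are merely bounded, and `‖w k‖ * M`
  -- dominates.
  obtain ⟨M, hM⟩ := (hd.norm).bddAbove_range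
  have hM' : ∀ N, ‖∑ n ∈ Finset.range N, d n‖ ≤ M := fun N => hM ⟨N, rfl⟩
  have hM0 : 0 ≤ M := (norm_nonneg _).trans (hM' 0)
  have h1 : ∀ N, ∑ n ∈ Finset.range N, cauchyProd w d n
      = ∑' k, if k < N then w k * ∑ j ∈ Finset.range (N - k), d j else 0 := by
    intro N
    rw [sum_range_cauchyProd, tsum_eq_sum (s := Finset.range N)]
    · exact Finset.sum_congr rfl fun k hk => by simp [Finset.mem_range.1 hk]
    · intro k hk
      simp only [Finset.mem_range] at hk
      simp [hk]
  simp_rw [h1]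
  rw [← tsum_mul_right]
  refine tendsto_tsum_of_dominated_convergence (bound := fun k => ‖w k‖ * M)
    (hw.mul_right M) (fun k => ?_) (Eventually.of_forall fun N k => ?_)
  · have h2 : Tendsto (fun N => w k * ∑ j ∈ Finset.range (N - k), d j) atTop (𝓝 (w k * s)) :=
      (hd.comp (tendsto_sub_atTop_nat k)).const_mul _
    refine h2.congr' ?_
    filter_upwards [eventually_gt_atTop k] with N hN
    simp [hN]
  · split_ifs
    · rw [norm_mul]
      exact mul_le_mul_of_nonneg_left (hM' _) (norm_nonneg _)
    · simpa using mul_nonneg (norm_nonneg _) hM0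

/-! ### Suprema of power series -/

theorem normSeries_le {m : ℕ} {a : ℕ → ℂ} {s : ℂ}
    (h : Tendsto (fun N => ∑ n ∈ Finset.Ico m N, a n) atTop (𝓝 s)) : normSeries m a ≤ ‖s‖ₑ :=
  iInf₂_le s h

theorem exists_tendsto_of_normSeries_lt_top {m : ℕ} {a : ℕ → ℂ} (h : normSeries m a < ⊤) :
    ∃ s, Tendsto (fun N => ∑ n ∈ Finset.Ico m N, a n) atTop (𝓝 s) ∧ normSeries m a = ‖s‖ₑ := by
  obtain ⟨s, hs⟩ := iInf_lt_iff.1 h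
  obtain ⟨hs, -⟩ := iInf_lt_iff.1 hs
  refine ⟨s, hs, le_antisymm (normSeries_le hs) (le_iInf₂ fun t ht => ?_)⟩
  rw [tendsto_nhds_unique hs ht]

theorem supSeries_congr {m : ℕ} {c c' : ℕ → ℝ} (h : ∀ n, m ≤ n → c n = c' n) (r : ℝ≥0) :
    supSeries m c r = supSeries m c' r := by
  unfold supSeries normSeries
  refine iSup_congr fun z => iSup_congr fun _ => ?_
  have : ∀ N, ∑ n ∈ Finset.Ico m N, (c n : ℂ) * z ^ n = ∑ n ∈ Finset.Ico m N, (c' n : ℂ) * z ^ n :=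
    fun N => Finset.sum_congr rfl fun n hn => by rw [h n (Finset.mem_Ico.1 hn).1]
  simp_rw [this]

theorem supSeries_one_eq {c : ℕ → ℝ} (h : c 0 = 0) (r : ℝ≥0) :
    supSeries 1 c r = supSeries 0 c r := by
  unfold supSeries normSeries
  refine iSup_congr fun z => iSup_congr fun _ => ?_
  have : ∀ N, ∑ n ∈ Finset.Ico 1 N, (c n : ℂ) * z ^ n = ∑ n ∈ Finset.Ico 0 N, (c n : ℂ) * z ^ n := by
    intro N
    rcases Nat.eq_zero_or_pos N with rfl | hN
    · simp
    · rw [Finset.sum_eq_sum_Ico_succ_bot hN]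
      simp [h]
  simp_rw [this]

theorem supSeries_add_le (m : ℕ) (c c' : ℕ → ℝ) (r : ℝ≥0) :
    supSeries m (fun n => c n + c' n) r ≤ supSeries m c r + supSeries m c' r := by
  refine iSup₂_le fun z hz => ?_
  refine le_trans ?_ (add_le_add (le_iSup₂ (f := fun (z : ℂ) (_ : ‖z‖ ≤ r) =>
    normSeries m fun n => (c n : ℂ) * z ^ n) z hz) (le_iSup₂ (f := fun (z : ℂ) (_ : ‖z‖ ≤ r) =>
    normSeries m fun n => (c' n : ℂ) * z ^ n) z hz))
  by_cases h1 : normSeries m (fun n => (c n : ℂ) * z ^ n) < ⊤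
  swap
  · simp [not_lt_top_iff.1 h1]
  by_cases h2 : normSeries m (fun n => (c' n : ℂ) * z ^ n) < ⊤
  swap
  · simp [not_lt_top_iff.1 h2]
  obtain ⟨s, hs, hs'⟩ := exists_tendsto_of_normSeries_lt_top h1
  obtain ⟨t, ht, ht'⟩ := exists_tendsto_of_normSeries_lt_top h2
  rw [hs', ht']
  refine (normSeries_le (s := s + t) ?_).trans (enorm_add_le _ _)
  refine (hs.add ht).congr fun N => ?_
  rw [← Finset.sum_add_distrib]
  exact Finset.sum_congr rfl fun n _ => by push_cast; ring

theorem enorm_mul_pow_le (c : ℝ) {z : ℂ} {r : ℝ≥0} (hz : ‖z‖ ≤ r) (n : ℕ) :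
    ‖(c : ℂ) * z ^ n‖ₑ ≤ ‖c‖ₑ * (r : ℝ≥0∞) ^ n := by
  rw [enorm_mul, enorm_pow]
  gcongr
  · exact le_of_eq (by simp [enorm])
  · rw [enorm_eq_nnnorm]
    exact_mod_cast hz

theorem summable_norm_of_tsum_enorm_ne_top {a : ℕ → ℂ} (h : ∑' n, ‖a n‖ₑ ≠ ⊤) :
    Summable fun n => ‖a n‖ := by
  simpa [enorm_eq_nnnorm, ← NNReal.summable_coe] using ENNReal.tsum_coe_ne_top_iff_summable.1 h

theorem supSeries_zero_le_tsum (c : ℕ → ℝ) (r : ℝ≥0) :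
    supSeries 0 c r ≤ ∑' n, ‖c n‖ₑ * (r : ℝ≥0∞) ^ n := by
  refine iSup₂_le fun z hz => ?_
  have hle : ∑' n, ‖(c n : ℂ) * z ^ n‖ₑ ≤ ∑' n, ‖c n‖ₑ * (r : ℝ≥0∞) ^ n :=
    ENNReal.tsum_le_tsum fun n => enorm_mul_pow_le _ hz n
  by_cases h : ∑' n, ‖c n‖ₑ * (r : ℝ≥0∞) ^ n = ⊤
  · simp [h]
  have hs : Summable fun n => (c n : ℂ) * z ^ n :=
    (summable_norm_of_tsum_enorm_ne_top (ne_top_of_le_ne_top h hle)).of_norm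
  refine (normSeries_le (s := ∑' n, (c n : ℂ) * z ^ n) ?_).trans
    ((enorm_tsum_le_tsum_enorm).trans hle)
  simpa using hs.hasSum.tendsto_sum_nat

/-- Mertens' theorem at each fixed `z`: absolute convergence is needed of `w` alone, since
finiteness of the last factor only gives convergence of the series of `d`. -/
theorem supSeries_zero_cauchyProd_le {w : ℕ → ℝ} (d : ℕ → ℝ) {r : ℝ≥0}
    (hw : ∑' n, ‖w n‖ₑ * (r : ℝ≥0∞) ^ n ≠ ⊤) :
    supSeries 0 (cauchyProd w d) r ≤ (∑' n, ‖w n‖ₑ * (r : ℝ≥0∞) ^ n) * supSeries 0 d r := by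
  refine iSup₂_le fun z hz => ?_
  have hle : ∑' n, ‖(w n : ℂ) * z ^ n‖ₑ ≤ ∑' n, ‖w n‖ₑ * (r : ℝ≥0∞) ^ n :=
    ENNReal.tsum_le_tsum fun n => enorm_mul_pow_le _ hz n
  have hs : Summable fun n => ‖(w n : ℂ) * z ^ n‖ :=
    summable_norm_of_tsum_enorm_ne_top (ne_top_of_le_ne_top hw hle)
  have hprod : (fun n => ((cauchyProd w d n : ℝ) : ℂ) * z ^ n)
      = cauchyProd (fun n => (w n : ℂ) * z ^ n) (fun n => (d n : ℂ) * z ^ n) := by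
    ext n
    rw [ofReal_cauchyProd, cauchyProd_mul_pow]
  rw [hprod]
  refine le_trans ?_ (mul_le_mul_right (le_iSup₂ (f := fun (z : ℂ) (_ : ‖z‖ ≤ r) =>
    normSeries 0 fun n => (d n : ℂ) * z ^ n) z hz) _)
  -- The case `0 * ⊤ = 0`: the product series vanishes identically even where the series of `d`
  -- diverges.
  by_cases h0 : ∑' n, ‖w n‖ₑ * (r : ℝ≥0∞) ^ n = 0
  · have hz0 : ∀ n, (w n : ℂ) * z ^ n = 0 := by
      rw [h0, nonpos_iff_eq_zero, ENNReal.tsum_eq_zero] at hle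
      intro n
      simpa using hle n
    rw [h0, zero_mul]
    refine (normSeries_le (s := 0) ?_).trans (by simp)
    simp [cauchyProd, hz0]
  by_cases h1 : normSeries 0 (fun n => (d n : ℂ) * z ^ n) < ⊤
  swap
  · rw [not_lt_top_iff.1 h1, ENNReal.mul_top h0]
    exact le_top
  obtain ⟨s, hs1, hs2⟩ := exists_tendsto_of_normSeries_lt_top h1
  rw [hs2]
  refine (normSeries_le (s := (∑' n, (w n : ℂ) * z ^ n) * s) ?_).trans ?_
  · simpa using tendsto_sum_cauchyProd hs (by simpa using hs1)
  · rw [enorm_mul]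
    gcongr
    exact enorm_tsum_le_tsum_enorm.trans hle

theorem tsum_enorm_cauchyProd_le (a b : ℕ → ℝ) (r : ℝ≥0) :
    ∑' n, ‖cauchyProd a b n‖ₑ * (r : ℝ≥0∞) ^ n
      ≤ (∑' n, ‖a n‖ₑ * (r : ℝ≥0∞) ^ n) * ∑' n, ‖b n‖ₑ * (r : ℝ≥0∞) ^ n := by
  rw [← tsum_cauchyProd]
  refine ENNReal.tsum_le_tsum fun n => ?_
  rw [← cauchyProd_mul_pow]
  gcongr
  exact enorm_cauchyProd_le a b n

/-- The geometric sum in additive form, with no quotient and no truncated difference of powers, so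
that it can be summed over `k` in `[0, ∞]`. -/
theorem sub_one_mul_geom_sum_add_one {r : ℝ≥0} (hr : 1 < r) (k : ℕ) :
    ((r : ℝ≥0∞) - 1) * ∑ m ∈ Finset.range k, (r : ℝ≥0∞) ^ m + 1 = (r : ℝ≥0∞) ^ k := by
  have h1 : (r : ℝ≥0∞) - 1 + 1 = r := tsub_add_cancel_of_le (by exact_mod_cast hr.le)
  induction k with
  | zero => simp
  | succ k ih =>
    rw [Finset.sum_range_succ, mul_add, add_right_comm, ih, pow_succ', add_comm]
    nth_rw 4 [← h1]
    ring

theorem sub_one_mul_geom_sum_Ico_add {r : ℝ≥0} (hr : 1 < r) {k : ℕ} (hk : 1 ≤ k) :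
    ((r : ℝ≥0∞) - 1) * ∑ m ∈ Finset.Ico 1 k, (r : ℝ≥0∞) ^ m + r = (r : ℝ≥0∞) ^ k := by
  have h1 : (r : ℝ≥0∞) - 1 + 1 = r := tsub_add_cancel_of_le (by exact_mod_cast hr.le)
  have h2 := sub_one_mul_geom_sum_add_one hr k
  rw [Finset.range_eq_Ico, Finset.sum_eq_sum_Ico_succ_bot (by omega)] at h2
  rw [← h2, mul_add, add_right_comm, add_comm, pow_zero, mul_one, h1, zero_add]

/-- The generating function of the tails of a series, in terms of that of the series itself. -/
theorem sub_one_mul_tsum_tail_add {r : ℝ≥0} (hr : 1 < r) {τ : ℕ → ℝ≥0∞} (h0 : τ 0 = 0) :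
    ((r : ℝ≥0∞) - 1) * (∑' n, (if 1 ≤ n then ∑' j, if n < j then τ j else 0 else 0)
      * (r : ℝ≥0∞) ^ n) + r * ∑' j, τ j = ∑' j, τ j * (r : ℝ≥0∞) ^ j := by
  have h1 : ∀ n, (if 1 ≤ n then ∑' j, if n < j then τ j else 0 else 0) * (r : ℝ≥0∞) ^ n
      = ∑' j, τ j * if n ∈ Finset.Ico 1 j then (r : ℝ≥0∞) ^ n else 0 := by
    intro n
    by_cases hn : 1 ≤ n
    · simp only [hn, if_true, ← ENNReal.tsum_mul_right, Finset.mem_Ico, true_and]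
      exact tsum_congr fun j => by split_ifs <;> simp
    · simp [hn]
  simp_rw [h1]
  rw [ENNReal.tsum_comm, ← ENNReal.tsum_mul_left, ← ENNReal.tsum_mul_left, ← ENNReal.tsum_add]
  refine tsum_congr fun j => ?_
  -- After the interchange of sums, `τ j` carries `∑_{1 ≤ n < j} r^n`. The closed form of this sum
  -- needs `j ≥ 1`, whence `τ 0 = 0`.
  rcases Nat.eq_zero_or_pos j with rfl | hj
  · simp [h0]
  · rw [ENNReal.tsum_mul_left, tsum_eq_sum (s := Finset.Ico 1 j) (fun n hn => by simp [hn]),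
      Finset.sum_congr rfl (fun n hn => if_pos hn), ← sub_one_mul_geom_sum_Ico_add hr hj]
    ring

theorem enorm_mul_le_of_mem_unitInterval {v : ℝ} (h0 : 0 ≤ v) (h1 : v ≤ 1) (x : ℝ) :
    ‖-v * x‖ₑ ≤ ‖x‖ₑ := by
  rw [enorm_mul, enorm_neg, Real.enorm_eq_ofReal h0]
  exact mul_le_of_le_one_left (by simp) (by simpa using h1)

/-- Term by term form of the regeneration decomposition, centred at its limit. -/
theorem renewal_decomposition {t a b u : ℕ → ℝ} (v : ℝ)
    (hab : ∀ n, ∑ k ∈ Finset.range (n + 1), a k + b n = 1) (ht : Summable t) (n : ℕ) :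
    cauchyProd a (cauchyProd u t) n - v * ∑' j, t j
      = cauchyProd (cauchyProd a t) (fun k => u k - v) n + cauchyProd (fun k => -v * t k) b n
        + -v * ∑' j, if n < j then t j else 0 := by
  have h1 : cauchyProd a (cauchyProd u t) n = cauchyProd (cauchyProd a t) u n := by
    rw [show cauchyProd u t = cauchyProd t u from funext fun _ => cauchyProd_comm _ _ _,
      cauchyProd_assoc]
  have h2 : cauchyProd (cauchyProd a t) u n = cauchyProd (cauchyProd a t) (fun k => u k - v) n
      + v * ∑ k ∈ Finset.range (n + 1), cauchyProd t a k := by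
    rw [Finset.sum_congr rfl fun k _ => cauchyProd_comm t a k]
    generalize cauchyProd a t = w
    rw [← Finset.Nat.sum_antidiagonal_eq_sum_range_succ (fun i _ => w i), Finset.mul_sum, cauchyProd,
      cauchyProd, ← Finset.sum_add_distrib]
    exact Finset.sum_congr rfl fun p _ => by ring
  -- Each `t k` meets the partial sum of `a` up to `n - k`, which is `1 - b (n - k)`.
  have h3 : ∑ k ∈ Finset.range (n + 1), cauchyProd t a k
      = ∑ k ∈ Finset.range (n + 1), t k - cauchyProd t b n := by
    rw [sum_range_cauchyProd, cauchyProd,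
      Finset.Nat.sum_antidiagonal_eq_sum_range_succ (fun i j => t i * b j),
      ← Finset.sum_sub_distrib]
    refine Finset.sum_congr rfl fun k hk => ?_
    have hk' : n + 1 - k = (n - k) + 1 := by have := Finset.mem_range.1 hk; omega
    rw [hk']
    linear_combination t k * hab (n - k)
  have h4 : ∑' j, t j = ∑ k ∈ Finset.range (n + 1), t k + ∑' j, if n < j then t j else 0 := by
    rw [← ht.sum_add_tsum_nat_add (n + 1)]
    congr 1
    have hs : Summable fun j => if n < j then t j else 0 :=
      (ht.indicator {j | n < j}).congr fun j => by simp [Set.indicator]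
    rw [← hs.sum_add_tsum_nat_add (n + 1), Finset.sum_eq_zero, zero_add]
    · exact tsum_congr fun j => by rw [if_pos (by omega)]
    · intro j hj
      exact if_neg (by have := Finset.mem_range.1 hj; omega)
  have h5 : cauchyProd (fun k => -v * t k) b n = -v * cauchyProd t b n := by
    simp only [cauchyProd, Finset.mul_sum, mul_assoc]
  rw [h1, h2, h3, h4, h5]
  ring

/-- The analytic half of the argument, free of probability. The factor `u - v` is estimated through
Mertens' theorem; the other three series are majorized absolutely, with `|v| ≤ 1`. -/
theorem supSeries_renewal_le {f t a b u c : ℕ → ℝ} {v : ℝ} {e τ α β : ℕ → ℝ≥0∞} {r : ℝ≥0}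
    (hr : 1 < r) (hf : ∀ n, ‖f n‖ₑ ≤ e n) (ht : ∀ n, ‖t n‖ₑ ≤ τ n) (ha : ∀ n, ‖a n‖ₑ ≤ α n)
    (hb : ∀ n, ‖b n‖ₑ ≤ β n) (hf0 : f 0 = 0) (ht0 : t 0 = 0)
    (hab : ∀ n, ∑ k ∈ Finset.range (n + 1), a k + b n = 1) (hv0 : 0 ≤ v) (hv1 : v ≤ 1)
    (hc : ∀ n, 1 ≤ n → c n = f n + cauchyProd a (cauchyProd u t) n - v * ∑' j, t j)
    (hτ : ∑' n, τ n * (r : ℝ≥0∞) ^ n ≠ ⊤)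
    (hατ : (∑' n, α n * (r : ℝ≥0∞) ^ n) * ∑' n, τ n * (r : ℝ≥0∞) ^ n ≠ ⊤) :
    supSeries 1 c r ≤ ∑' n, e n * (r : ℝ≥0∞) ^ n
      + (∑' n, α n * (r : ℝ≥0∞) ^ n) * (∑' n, τ n * (r : ℝ≥0∞) ^ n)
        * supSeries 0 (fun n => u n - v) r
      + (∑' n, τ n * (r : ℝ≥0∞) ^ n) * (∑' n, β n * (r : ℝ≥0∞) ^ n)
      + ∑' n, (if 1 ≤ n then ∑' j, if n < j then τ j else 0 else 0) * (r : ℝ≥0∞) ^ n := by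
  have hr1 : ∀ n, 1 ≤ (r : ℝ≥0∞) ^ n := fun n => one_le_pow₀ (by exact_mod_cast hr.le)
  have hts : Summable t := by
    have h1 : ∑' n, ‖(t n : ℂ)‖ₑ ≠ ⊤ := by
      refine ne_top_of_le_ne_top hτ (ENNReal.tsum_le_tsum fun n => ?_)
      calc ‖(t n : ℂ)‖ₑ = ‖t n‖ₑ := by simp [enorm]
        _ ≤ τ n := ht n
        _ ≤ τ n * (r : ℝ≥0∞) ^ n := le_mul_of_one_le_right zero_le (hr1 n)
    have h2 := summable_norm_of_tsum_enorm_ne_top h1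
    simp only [Complex.norm_real] at h2
    exact h2.of_norm
  -- The tail is replaced by `0` at `n = 0`. Then all four constant terms vanish and the series may
  -- start at `0`, as the Cauchy product estimates require.
  have hdec : ∀ n, 1 ≤ n → c n = f n + cauchyProd (cauchyProd a t) (fun k => u k - v) n
      + cauchyProd (fun k => -v * t k) b n
      + (if 1 ≤ n then -v * ∑' j, if n < j then t j else 0 else 0) := by
    intro n hn
    rw [hc n hn, if_pos hn, add_sub_assoc, renewal_decomposition v hab hts n]
    ring
  rw [supSeries_congr hdec, supSeries_one_eq (by simp [cauchyProd, hf0, ht0])]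
  have hw : ∑' n, ‖cauchyProd a t n‖ₑ * (r : ℝ≥0∞) ^ n
      ≤ (∑' n, α n * (r : ℝ≥0∞) ^ n) * ∑' n, τ n * (r : ℝ≥0∞) ^ n :=
    (tsum_enorm_cauchyProd_le a t r).trans (by gcongr <;> apply_assumption)
  refine (supSeries_add_le _ _ _ _).trans (add_le_add ((supSeries_add_le _ _ _ _).trans
    (add_le_add ((supSeries_add_le _ _ _ _).trans (add_le_add ?_ ?_)) ?_)) ?_)
  · refine (supSeries_zero_le_tsum _ _).trans ?_
    gcongr
    apply_assumption
  · refine (supSeries_zero_cauchyProd_le _ (ne_top_of_le_ne_top hατ hw)).trans ?_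
    gcongr
  · refine (supSeries_zero_le_tsum _ _).trans ((tsum_enorm_cauchyProd_le _ _ _).trans ?_)
    gcongr with n n
    · exact (enorm_mul_le_of_mem_unitInterval hv0 hv1 _).trans (ht n)
    · exact hb n
  · refine (supSeries_zero_le_tsum _ _).trans ?_
    gcongr with n
    split_ifs with hn
    · refine (enorm_mul_le_of_mem_unitInterval hv0 hv1 _).trans
        (enorm_tsum_le_tsum_enorm.trans (ENNReal.tsum_le_tsum fun j => ?_))
      split_ifs
      · exact ht j
      · simp
    · simp

/-! ### One-step operators of a chain with an atom -/

section Operators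

variable {S : Type*} [MeasurableSpace S] {K : Kernel (S × Bool) (S × Bool)}

/-- The set `{Y = i}` in the state space of the split chain. -/
def level (S : Type*) (i : Bool) : Set (S × Bool) := {q | q.2 = i}

theorem measurableSet_level (i : Bool) : MeasurableSet (level S i) :=
  measurable_snd (measurableSet_singleton i)

omit [MeasurableSpace S] in
theorem compl_level_true : (level S true)ᶜ = level S false := by
  ext q
  simp [level]

/-- The transition operator of the kernel `K`. -/
noncomputable def stepOp (K : Kernel (S × Bool) (S × Bool)) (F : S × Bool → ℝ≥0∞)
    (p : S × Bool) : ℝ≥0∞ :=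
  ∫⁻ q, F q ∂K p

/-- The transition operator of the kernel `K` killed on `{Y = 1}`. -/
noncomputable def tabooOp (K : Kernel (S × Bool) (S × Bool)) (F : S × Bool → ℝ≥0∞)
    (p : S × Bool) : ℝ≥0∞ :=
  ∫⁻ q in level S false, F q ∂K p

theorem measurable_stepOp {F : S × Bool → ℝ≥0∞} (hF : Measurable F) : Measurable (stepOp K F) :=
  hF.lintegral_kernel

theorem measurable_tabooOp {F : S × Bool → ℝ≥0∞} (hF : Measurable F) :
    Measurable (tabooOp K F) := by
  have h : tabooOp K F = stepOp K ((level S false).indicator F) := by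
    ext p
    rw [stepOp, lintegral_indicator (measurableSet_level false), tabooOp]
  rw [h]
  exact measurable_stepOp (hF.indicator (measurableSet_level false))

theorem measurable_iterate_stepOp {F : S × Bool → ℝ≥0∞} (hF : Measurable F) (n : ℕ) :
    Measurable ((stepOp K)^[n] F) := by
  induction n with
  | zero => exact hF
  | succ n ih =>
    rw [Function.iterate_succ_apply']
    exact measurable_stepOp ih

theorem measurable_iterate_tabooOp {F : S × Bool → ℝ≥0∞} (hF : Measurable F) (n : ℕ) :
    Measurable ((tabooOp K)^[n] F) := by
  induction n with
  | zero => exact hF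
  | succ n ih =>
    rw [Function.iterate_succ_apply']
    exact measurable_tabooOp ih

/-- The indicator function of `{Y = 1}`. -/
noncomputable def atomInd (S : Type*) : S × Bool → ℝ≥0∞ := (level S true).indicator 1

theorem measurable_atomInd : Measurable (atomInd S) :=
  measurable_one.indicator (measurableSet_level true)

theorem stepOp_atomInd (p : S × Bool) : stepOp K (atomInd S) p = K p (level S true) := by
  simp [stepOp, atomInd, lintegral_indicator_one (measurableSet_level true)]

/-- The step either avoids `{Y = 1}` or enters it; in the latter case `F` is constant and only the
probability of entering remains. -/
theorem stepOp_eq_tabooOp_add {F : S × Bool → ℝ≥0∞} {c : ℝ≥0∞} (hF : ∀ y, F (y, true) = c)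
    (p : S × Bool) : stepOp K F p = tabooOp K F p + stepOp K (atomInd S) p * c := by
  rw [stepOp_atomInd, stepOp, tabooOp, ← lintegral_add_compl _ (measurableSet_level true),
    compl_level_true, add_comm]
  congr 1
  rw [setLIntegral_congr_fun (g := fun _ => c) (measurableSet_level true), setLIntegral_const,
    mul_comm]
  rintro ⟨y, i⟩ hi
  obtain rfl : i = true := hi
  exact hF y

variable (hK : ∀ x y, K (x, true) = K (y, true))
include hK

theorem stepOp_atom (F : S × Bool → ℝ≥0∞) (x y : S) :
    stepOp K F (y, true) = stepOp K F (x, true) := by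
  simp only [stepOp, hK y x]

/-- At least one step is needed: `F` itself may vary over `{Y = 1}`, but the law of the next state
does not. -/
theorem iterate_stepOp_succ_atom (F : S × Bool → ℝ≥0∞) (n : ℕ) (x y : S) :
    (stepOp K)^[n + 1] F (y, true) = (stepOp K)^[n + 1] F (x, true) := by
  rw [Function.iterate_succ_apply']
  exact stepOp_atom hK _ x y

theorem iterate_tabooOp_atom (F : S × Bool → ℝ≥0∞) (n : ℕ) (x y : S) :
    (tabooOp K)^[n] (stepOp K F) (y, true) = (tabooOp K)^[n] (stepOp K F) (x, true) := by
  cases n with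
  | zero => exact stepOp_atom hK F x y
  | succ n =>
    rw [Function.iterate_succ_apply']
    simp only [tabooOp, hK y x]

/-- Decomposition according to the first visit to the atom. -/
theorem first_entrance {F : S × Bool → ℝ≥0∞} (hF : Measurable F) (a : S) (n : ℕ)
    (p : S × Bool) :
    (stepOp K)^[n + 1] F p = (tabooOp K)^[n] (stepOp K F) p
      + ∑ k ∈ Finset.range n,
        (tabooOp K)^[k] (stepOp K (atomInd S)) p * (stepOp K)^[n - k] F (a, true) := by
  induction n generalizing p with
  | zero => simp
  | succ n ih =>
    -- The first step is singled out. If it enters the atom it gives the summand `k = 0`; otherwise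
    -- the induction hypothesis is integrated against the killed kernel.
    rw [Function.iterate_succ_apply',
      stepOp_eq_tabooOp_add (fun y => iterate_stepOp_succ_atom hK F n a y), Finset.sum_range_succ',
      ← add_assoc]
    congr 1
    rw [tabooOp, lintegral_congr ih, lintegral_add_left
      (measurable_iterate_tabooOp (measurable_stepOp hF) n), lintegral_finsetSum _ fun k _ =>
      (measurable_iterate_tabooOp (measurable_stepOp measurable_atomInd) k).mul_const _,
      Function.iterate_succ_apply' (tabooOp K)]
    congr 1
    refine Finset.sum_congr rfl fun k _ => ?_
    rw [lintegral_mul_const _ (measurable_iterate_tabooOp (measurable_stepOp measurable_atomInd) k),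
      Function.iterate_succ_apply', Nat.add_sub_add_right]
    rfl

/-- Decomposition according to the last visit to the atom. -/
theorem last_exit {F : S × Bool → ℝ≥0∞} (hF : Measurable F) (a : S) (n : ℕ) (p : S × Bool) :
    (stepOp K)^[n + 1] F p = (tabooOp K)^[n] (stepOp K F) p
      + ∑ k ∈ Finset.range n, (stepOp K)^[k + 1] (atomInd S) p
        * (tabooOp K)^[n - (k + 1)] (stepOp K F) (a, true) := by
  induction n generalizing p with
  | zero => simp
  | succ n ih =>
    rw [Function.iterate_succ_apply', stepOp, lintegral_congr ih, lintegral_add_left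
      (measurable_iterate_tabooOp (measurable_stepOp hF) n), lintegral_finsetSum _ fun k _ =>
      (measurable_iterate_stepOp measurable_atomInd _).mul_const _]
    -- The visit-free term of the induction hypothesis splits: a first step into the atom makes time
    -- `1` the last visit, which is the summand `k = 0`.
    rw [Finset.sum_range_succ', ← stepOp,
      stepOp_eq_tabooOp_add (fun y => iterate_tabooOp_atom hK F n a y),
      Function.iterate_succ_apply' (tabooOp K), add_assoc, add_comm (stepOp K (atomInd S) p * _)]
    congr 2
    refine Finset.sum_congr rfl fun k _ => ?_
    rw [lintegral_mul_const _ (measurable_iterate_stepOp measurable_atomInd _),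
      Function.iterate_succ_apply' (n := k + 1), Nat.add_sub_add_right]
    rfl

end Operators

/-! ### Finite-dimensional laws of the split chain -/

section PathLaw

variable {S : Type*}

/-- The event `{n ≤ T}`. -/
def surv (S : Type*) (n : ℕ) : Set (ℕ → S × Bool) := {ω | (n : ℕ∞) ≤ regTime ω}

theorem mem_surv_iff {n : ℕ} {ω : ℕ → S × Bool} :
    ω ∈ surv S n ↔ ∀ k, 1 ≤ k → k < n → (ω k).2 = false := by
  simp only [surv, regTime, Set.mem_ofPred_eq, le_iInf_iff, Nat.cast_le]
  refine forall_congr' fun k => ?_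
  by_cases h : (ω k).2 = true <;> simp [h]

theorem surv_one : surv S 1 = Set.univ := by
  ext ω
  simp only [mem_surv_iff, Set.mem_univ, iff_true]
  intros
  omega

theorem surv_succ {n : ℕ} (hn : 1 ≤ n) :
    surv S (n + 1) = surv S n ∩ {ω | ω n ∈ level S false} := by
  ext ω
  simp only [mem_surv_iff, Set.mem_inter_iff, Set.mem_ofPred_eq, level]
  refine ⟨fun h => ⟨fun k h1 h2 => h k h1 (by omega), h n hn (by omega)⟩, fun h k h1 h2 => ?_⟩
  rcases Nat.lt_succ_iff_lt_or_eq.1 h2 with h3 | rfl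
  · exact h.1 k h1 h3
  · exact h.2

variable [MeasurableSpace S]

/-- Whether `T ≥ n + 1` is decided by the coordinates up to time `n`, so the Markov property at time
`n` applies on this event. -/
theorem exists_surv_succ_eq_preimage (n : ℕ) :
    ∃ s, MeasurableSet s ∧ surv S (n + 1) = Preorder.frestrictLe (π := fun _ => S × Bool) n ⁻¹' s := by
  refine ⟨⋂ k : Finset.Iic n, {y | 1 ≤ k.1 → (y k).2 = false}, ?_, ?_⟩
  · refine MeasurableSet.iInter fun k => ?_
    by_cases hk : 1 ≤ k.1
    · simp only [hk, true_imp_iff]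
      exact (measurable_snd.comp (measurable_pi_apply k)) (measurableSet_singleton false)
    · simp [hk]
  · ext ω
    simp only [mem_surv_iff, Set.mem_preimage, Set.mem_iInter, Set.mem_ofPred_eq, Subtype.forall,
      Finset.mem_Iic, Preorder.frestrictLe_apply]
    exact ⟨fun h k h1 h2 => h k h2 (by omega), fun h k h1 h2 => h k (by omega) h1⟩

theorem measurableSet_surv (n : ℕ) : MeasurableSet (surv S n) := by
  cases n with
  | zero => simp [surv]
  | succ n =>
    obtain ⟨s, hs, h⟩ := exists_surv_succ_eq_preimage (S := S) n
    rw [h]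
    exact Preorder.measurable_frestrictLe n hs

variable {P : Kernel S S} [IsMarkovKernel P] {C : Set S} {β : ℝ≥0} {ν : Measure S}
  [IsProbabilityMeasure ν] (h : IsMinorized P C β ν)

instance (p : S × Bool) : IsProbabilityMeasure (pathLaw h p) := by
  unfold pathLaw
  infer_instance

theorem lintegral_pathLaw_zero (p : S × Bool) {F : S × Bool → ℝ≥0∞} (hF : Measurable F) :
    ∫⁻ ω, F (ω 0) ∂pathLaw h p = F p := by
  have hm : Measurable fun ω : ℕ → S × Bool => F (ω 0) := hF.comp (measurable_pi_apply 0)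
  rw [pathLaw, Kernel.lintegral_traj _ hm]
  simp [Function.updateFinset]

/-- The Markov property at time `n`. -/
theorem setLIntegral_pathLaw_succ (p : S × Bool) {F : S × Bool → ℝ≥0∞} (hF : Measurable F) {n : ℕ}
    {s : Set ((i : Finset.Iic n) → S × Bool)} (hs : MeasurableSet s) :
    ∫⁻ ω in Preorder.frestrictLe (π := fun _ => S × Bool) n ⁻¹' s, F (ω (n + 1)) ∂pathLaw h p
      = ∫⁻ ω in Preorder.frestrictLe (π := fun _ => S × Bool) n ⁻¹' s,
        stepOp (chainKernel h) F (ω n) ∂pathLaw h p := by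
  set κ : (n : ℕ) → Kernel ((i : Finset.Iic n) → S × Bool) (S × Bool) := fun n =>
    (chainKernel h).comap (fun y : (i : Finset.Iic n) → S × Bool => y ⟨n, Finset.mem_Iic.2 le_rfl⟩)
      (measurable_pi_apply _) with hκ
  have hm : Measurable fun ω : ℕ → S × Bool =>
      (Preorder.frestrictLe (π := fun _ => S × Bool) n ω, ω (n + 1)) :=
    (Preorder.measurable_frestrictLe n).prodMk (measurable_pi_apply _)
  -- The joint law of the path up to time `n` and of the next state is the law of the former
  -- composed with the transition kernel.
  have hmap := Kernel.partialTraj_compProd_eq_map_traj (X := fun _ => S × Bool) (κ := κ)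
    (Nat.zero_le n) (x₀ := fun _ => p)
  have hG : Measurable fun q : ((i : Finset.Iic n) → S × Bool) × (S × Bool) => F q.2 :=
    hF.comp measurable_snd
  have h1 : ∫⁻ ω in Preorder.frestrictLe (π := fun _ => S × Bool) n ⁻¹' s, F (ω (n + 1))
      ∂pathLaw h p = ∫⁻ q in s ×ˢ Set.univ, F q.2
      ∂((Kernel.traj κ 0 fun _ => p).map fun ω =>
        (Preorder.frestrictLe (π := fun _ => S × Bool) n ω, ω (n + 1))) := by
    rw [setLIntegral_map (hs.prod MeasurableSet.univ) hG hm]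
    simp [pathLaw, κ, Set.prod_univ, Set.preimage_preimage]
  rw [h1, ← hmap, Measure.setLIntegral_compProd hG hs MeasurableSet.univ,
    ← Kernel.traj_map_frestrictLe_apply, setLIntegral_map hs _ (Preorder.measurable_frestrictLe n)]
  · simp only [Measure.restrict_univ]
    rfl
  · simp only [Measure.restrict_univ]
    change Measurable (stepOp (chainKernel h) F ∘
      fun y : (i : Finset.Iic n) → S × Bool => y ⟨n, Finset.mem_Iic.2 le_rfl⟩)
    exact (measurable_stepOp hF).comp (measurable_pi_apply _)

theorem lintegral_pathLaw (p : S × Bool) {F : S × Bool → ℝ≥0∞} (hF : Measurable F) (n : ℕ) :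
    ∫⁻ ω, F (ω n) ∂pathLaw h p = (stepOp (chainKernel h))^[n] F p := by
  induction n generalizing F with
  | zero => exact lintegral_pathLaw_zero h p hF
  | succ n ih =>
    have h1 := setLIntegral_pathLaw_succ h p hF (n := n) MeasurableSet.univ
    simp only [Set.preimage_univ, Measure.restrict_univ] at h1
    rw [h1, ih (measurable_stepOp hF), Function.iterate_succ_apply]

/-- Survival forbids visits at times `1, …, n` only. The last step is therefore not killed, and a
visit at time `n + 1` itself is allowed. -/
theorem setLIntegral_surv_pathLaw (p : S × Bool) {F : S × Bool → ℝ≥0∞} (hF : Measurable F)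
    (n : ℕ) :
    ∫⁻ ω in surv S (n + 1), F (ω (n + 1)) ∂pathLaw h p
      = (tabooOp (chainKernel h))^[n] (stepOp (chainKernel h) F) p := by
  induction n generalizing F with
  | zero =>
    simpa [surv_one] using lintegral_pathLaw h p hF 1
  | succ n ih =>
    obtain ⟨s, hs, h1⟩ := exists_surv_succ_eq_preimage (S := S) (n + 1)
    have hm : MeasurableSet {ω : ℕ → S × Bool | ω (n + 1) ∈ level S false} :=
      measurable_pi_apply (n + 1) (measurableSet_level false)
    rw [h1, setLIntegral_pathLaw_succ h p hF hs, ← h1, surv_succ (by omega), Set.inter_comm,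
      ← Measure.restrict_restrict hm,
      ← lintegral_indicator hm]
    -- The extra condition `Y_{n+1} = 0` is moved into the integrand; one step applied to the
    -- cut-off function is one killed step.
    have h2 := ih ((measurable_stepOp (K := chainKernel h) hF).indicator (measurableSet_level false))
    rw [Function.iterate_succ_apply]
    refine Eq.trans ?_ (h2.trans ?_)
    · rfl
    · refine congrArg (fun G => (tabooOp (chainKernel h))^[n] G p) (funext fun q => ?_)
      simp only [stepOp, tabooOp]
      rw [lintegral_indicator (measurableSet_level false)]
      rfl

end PathLaw

/-! ### Marginal laws of the split chain -/

section Marginals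

variable {S : Type*} [MeasurableSpace S] {P : Kernel S S} {C : Set S} {β : ℝ≥0} {ν : Measure S}

/-- The expectation of `φ (X, Y)` given `X = x`. -/
noncomputable def splitOp (C : Set S) (β : ℝ≥0) (φ : S × Bool → ℝ≥0∞) (x : S) : ℝ≥0∞ :=
  (1 - splitProb C β x) * φ (x, false) + splitProb C β x * φ (x, true)

omit [MeasurableSpace S] in
theorem splitOp_add (φ ψ : S × Bool → ℝ≥0∞) (x : S) :
    splitOp C β (fun p => φ p + ψ p) x = splitOp C β φ x + splitOp C β ψ x := by
  simp only [splitOp]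
  ring

omit [MeasurableSpace S] in
theorem splitOp_sum_mul (N : ℕ) (φ : ℕ → S × Bool → ℝ≥0∞) (c : ℕ → ℝ≥0∞) (x : S) :
    splitOp C β (fun p => ∑ k ∈ Finset.range N, φ k p * c k) x
      = ∑ k ∈ Finset.range N, splitOp C β (φ k) x * c k := by
  simp only [splitOp, Finset.mul_sum, ← Finset.sum_add_distrib]
  exact Finset.sum_congr rfl fun k _ => by ring

omit [MeasurableSpace S] in
theorem splitOp_atomInd (x : S) : splitOp C β (atomInd S) x = splitProb C β x := by
  simp [splitOp, atomInd, level]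

theorem splitOp_fst (h : IsMinorized P C β ν) (F : S → ℝ≥0∞) (x : S) :
    splitOp C β (fun p => F p.1) x = F x := by
  rw [splitOp, ← add_mul, tsub_add_cancel_of_le (splitProb_lt_one h x).le, one_mul]

theorem measurable_splitOp (h : IsMinorized P C β ν) {φ : S × Bool → ℝ≥0∞} (hφ : Measurable φ) :
    Measurable (splitOp C β φ) :=
  (((measurable_splitProb h).const_sub 1).mul (hφ.comp (measurable_id.prodMk measurable_const))).add
    ((measurable_splitProb h).mul (hφ.comp (measurable_id.prodMk measurable_const)))

theorem lintegral_splitKernel (h : IsMinorized P C β ν) {φ : S × Bool → ℝ≥0∞} (hφ : Measurable φ)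
    (x : S) : ∫⁻ q, φ q ∂splitKernel h x = splitOp C β φ x := by
  change ∫⁻ q, φ q ∂((1 - splitProb C β x) • Measure.dirac (x, false)
    + splitProb C β x • Measure.dirac (x, true)) = _
  simp [lintegral_add_measure, lintegral_smul_measure, lintegral_dirac' _ hφ, splitOp]

variable [IsProbabilityMeasure ν] (h : IsMinorized P C β ν)

theorem nextKernel_true (x : S) : nextKernel h (x, true) = ν := by
  change (if true = true then ν else residualKernel h x) = ν
  exact if_pos rfl

theorem nextKernel_false (x : S) : nextKernel h (x, false) = residualKernel h x := by
  change (if false = true then ν else residualKernel h x) = _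
  exact if_neg Bool.false_ne_true

theorem stepOp_chainKernel {φ : S × Bool → ℝ≥0∞} (hφ : Measurable φ) (p : S × Bool) :
    stepOp (chainKernel h) φ p = ∫⁻ y, splitOp C β φ y ∂nextKernel h p := by
  rw [stepOp, chainKernel, Kernel.lintegral_comp _ _ _ hφ]
  exact lintegral_congr fun y => lintegral_splitKernel h hφ y

theorem chainKernel_atom (x y : S) : chainKernel h (x, true) = chainKernel h (y, true) := by
  rw [chainKernel, Kernel.comp_apply, Kernel.comp_apply, nextKernel_true, nextKernel_true]

theorem smul_residualKernel_add (x : S) :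
    (1 - splitProb C β x) • residualKernel h x + splitProb C β x • ν = P x := by
  have hlt := splitProb_lt_one h x
  have : IsFiniteMeasure (splitProb C β x • ν) :=
    ⟨by simpa using hlt.trans ENNReal.one_lt_top⟩
  change (1 - splitProb C β x) • ((1 - splitProb C β x)⁻¹ • (P x - splitProb C β x • ν))
    + splitProb C β x • ν = P x
  rw [smul_smul, ENNReal.mul_inv_cancel (tsub_pos_of_lt hlt).ne'
    (ENNReal.sub_ne_top ENNReal.one_ne_top), one_smul,
    Measure.sub_add_cancel_of_le (splitProb_smul_le h x)]

/-- Averaging over the level mixes `ν` and the residual law with exactly the weights that restore `P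
x`. By iteration, the first coordinate of the split chain is the original chain. -/
theorem splitOp_stepOp {φ : S × Bool → ℝ≥0∞} (hφ : Measurable φ) (x : S) :
    splitOp C β (stepOp (chainKernel h) φ) x = ∫⁻ y, splitOp C β φ y ∂P x := by
  rw [splitOp, stepOp_chainKernel h hφ, stepOp_chainKernel h hφ]
  conv_rhs => rw [← smul_residualKernel_add h x]
  rw [lintegral_add_measure, lintegral_smul_measure, lintegral_smul_measure, nextKernel_true,
    nextKernel_false]
  rfl

theorem lintegral_kernel_pow_succ {F : S → ℝ≥0∞} (hF : Measurable F) (n : ℕ) (x : S) :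
    ∫⁻ y, F y ∂(P ^ (n + 1)) x = ∫⁻ y, ∫⁻ w, F w ∂(P ^ n) y ∂P x := by
  rw [pow_succ]
  exact Kernel.lintegral_comp _ _ _ hF

theorem splitOp_iterate_stepOp {φ : S × Bool → ℝ≥0∞} (hφ : Measurable φ) (n : ℕ) (x : S) :
    splitOp C β ((stepOp (chainKernel h))^[n] φ) x = ∫⁻ y, splitOp C β φ y ∂(P ^ n) x := by
  induction n generalizing x with
  | zero =>
    rw [pow_zero]
    change _ = ∫⁻ y, splitOp C β φ y ∂Kernel.id x
    rw [Kernel.id_apply, lintegral_dirac' _ (measurable_splitOp h hφ), Function.iterate_zero, id]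
  | succ n ih =>
    rw [Function.iterate_succ_apply', splitOp_stepOp h (measurable_iterate_stepOp hφ n),
      lintegral_congr ih, lintegral_kernel_pow_succ (measurable_splitOp h hφ)]

theorem iterate_stepOp_succ_true {φ : S × Bool → ℝ≥0∞} (hφ : Measurable φ) (n : ℕ) (a : S) :
    (stepOp (chainKernel h))^[n + 1] φ (a, true)
      = ∫⁻ y, ∫⁻ w, splitOp C β φ w ∂(P ^ n) y ∂ν := by
  rw [Function.iterate_succ_apply', stepOp_chainKernel h (measurable_iterate_stepOp hφ n),
    lintegral_congr (splitOp_iterate_stepOp h hφ n), nextKernel_true]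

variable [IsMarkovKernel P]

theorem lintegral_mixedPathLaw (x : S) (Φ : (ℕ → S × Bool) → ℝ≥0∞) :
    ∫⁻ ω, Φ ω ∂mixedPathLaw h x
      = splitOp C β (fun p => ∫⁻ ω, Φ ω ∂pathLaw h p) x := by
  simp [mixedPathLaw, splitOp, lintegral_add_measure, lintegral_smul_measure]

theorem setLIntegral_mixedPathLaw (x : S) (Φ : (ℕ → S × Bool) → ℝ≥0∞) (A : Set (ℕ → S × Bool)) :
    ∫⁻ ω in A, Φ ω ∂mixedPathLaw h x
      = splitOp C β (fun p => ∫⁻ ω in A, Φ ω ∂pathLaw h p) x := by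
  simp [mixedPathLaw, splitOp, lintegral_add_measure, lintegral_smul_measure]

instance (x : S) : IsProbabilityMeasure (mixedPathLaw h x) := by
  refine ⟨?_⟩
  rw [← lintegral_one, lintegral_mixedPathLaw]
  simpa using splitOp_fst h (fun _ => 1) x

end Marginals

/-! ### The regeneration decomposition -/

section Regeneration

variable {S : Type*} [MeasurableSpace S]

/-- `E(F(X_n, Y_n); n ≤ T)` for `n ≥ 1`, under the path law `Q`. -/
noncomputable def tabooTerm (Q : Measure (ℕ → S × Bool)) (F : S × Bool → ℝ≥0∞) (n : ℕ) : ℝ≥0∞ :=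
  if n = 0 then 0 else ∫⁻ ω in surv S n, F (ω n) ∂Q

@[simp]
theorem tabooTerm_zero (Q : Measure (ℕ → S × Bool)) (F : S × Bool → ℝ≥0∞) :
    tabooTerm Q F 0 = 0 :=
  if_pos rfl

theorem tabooTerm_succ (Q : Measure (ℕ → S × Bool)) (F : S × Bool → ℝ≥0∞) (n : ℕ) :
    tabooTerm Q F (n + 1) = ∫⁻ ω in surv S (n + 1), F (ω (n + 1)) ∂Q :=
  if_neg n.succ_ne_zero

variable {P : Kernel S S} {C : Set S} {β : ℝ≥0} {ν : Measure S}
  [IsMarkovKernel P] [IsProbabilityMeasure ν] (h : IsMinorized P C β ν)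

theorem tabooTerm_pathLaw_succ {F : S × Bool → ℝ≥0∞} (hF : Measurable F) (p : S × Bool) (n : ℕ) :
    tabooTerm (pathLaw h p) F (n + 1)
      = (tabooOp (chainKernel h))^[n] (stepOp (chainKernel h) F) p := by
  rw [tabooTerm_succ, setLIntegral_surv_pathLaw h p hF]

theorem tabooTerm_mixedPathLaw_succ {F : S × Bool → ℝ≥0∞} (hF : Measurable F) (x : S) (n : ℕ) :
    tabooTerm (mixedPathLaw h x) F (n + 1)
      = splitOp C β ((tabooOp (chainKernel h))^[n] (stepOp (chainKernel h) F)) x := by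
  rw [tabooTerm_succ, setLIntegral_mixedPathLaw]
  exact congrArg (fun G => splitOp C β G x) (funext fun p => setLIntegral_surv_pathLaw h p hF n)

/-- The renewal sequence, with values in `[0, ∞]`. -/
noncomputable def atomProb (a : S) (n : ℕ) : ℝ≥0∞ := ∫⁻ ω, atomInd S (ω n) ∂pathLaw h (a, true)

theorem atomProb_eq (a : S) (n : ℕ) :
    atomProb h a n = (stepOp (chainKernel h))^[n] (atomInd S) (a, true) :=
  lintegral_pathLaw h _ measurable_atomInd n

theorem atomProb_zero (a : S) : atomProb h a 0 = 1 := by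
  simp [atomProb_eq, atomInd, level]

theorem toReal_atomProb (a : S) (n : ℕ) : (atomProb h a n).toReal = renewalSeq h a n := by
  have hm : MeasurableSet {ω : ℕ → S × Bool | (ω n).2 = true} :=
    (measurable_snd.comp (measurable_pi_apply n)) (measurableSet_singleton true)
  rw [atomProb, renewalSeq, measureReal_def, ← lintegral_indicator_one hm]
  rfl

theorem atomProb_le_one (a : S) (n : ℕ) : atomProb h a n ≤ 1 := by
  refine (lintegral_mono (g := fun _ => 1) fun ω => ?_).trans (by simp)
  exact Set.indicator_le_self' (by simp) _

/-- The last-exit decomposition from the atom. As `u_0 = 1`, the visit-free term is the summand with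
last visit at time `0`. -/
theorem iterate_stepOp_eq_cauchyProd {F : S × Bool → ℝ≥0∞} (hF : Measurable F) (a : S) (n : ℕ) :
    (stepOp (chainKernel h))^[n + 1] F (a, true)
      = cauchyProd (atomProb h a) (tabooTerm (pathLaw h (a, true)) F) (n + 1) := by
  rw [last_exit (chainKernel_atom h) hF a, cauchyProd,
    Finset.Nat.sum_antidiagonal_eq_sum_range_succ (fun i j => atomProb h a i
      * tabooTerm (pathLaw h (a, true)) F j), Finset.sum_range_succ, Finset.sum_range_succ',
    tsub_self, tabooTerm_zero, mul_zero, add_zero, atomProb_zero, one_mul, tsub_zero,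
    tabooTerm_pathLaw_succ h hF, add_comm]
  congr 1
  refine Finset.sum_congr rfl fun k hk => ?_
  have hk' : n + 1 - (k + 1) = (n - (k + 1)) + 1 := by
    have := Finset.mem_range.1 hk
    omega
  rw [hk', tabooTerm_pathLaw_succ h hF, atomProb_eq]

/-- The first-entrance last-exit decomposition. -/
theorem lintegral_kernel_pow_eq {F : S → ℝ≥0∞} (hF : Measurable F) (a x : S) {n : ℕ}
    (hn : 1 ≤ n) :
    ∫⁻ y, F y ∂(P ^ n) x = tabooTerm (mixedPathLaw h x) (fun p => F p.1) n
      + cauchyProd (tabooTerm (mixedPathLaw h x) (atomInd S))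
        (cauchyProd (atomProb h a) (tabooTerm (pathLaw h (a, true)) fun p => F p.1)) n := by
  obtain ⟨m, rfl⟩ : ∃ m, n = m + 1 := ⟨n - 1, by omega⟩
  have hF' : Measurable fun p : S × Bool => F p.1 := hF.comp measurable_fst
  have h1 := splitOp_iterate_stepOp h hF' (m + 1) x
  simp_rw [splitOp_fst h] at h1
  rw [← h1, funext (first_entrance (chainKernel_atom h) hF' a m), splitOp_add, splitOp_sum_mul,
    tabooTerm_mixedPathLaw_succ h hF', cauchyProd,
    Finset.Nat.sum_antidiagonal_eq_sum_range_succ (fun i j =>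
      tabooTerm (mixedPathLaw h x) (atomInd S) i * cauchyProd (atomProb h a)
        (tabooTerm (pathLaw h (a, true)) fun p => F p.1) j), Finset.sum_range_succ',
    Finset.sum_range_succ, tabooTerm_zero, zero_mul, add_zero, tsub_self]
  -- The summand with first visit at time `n` itself must vanish: that event is already part of `{n
  -- ≤ T}` in the first term.
  have h0 : cauchyProd (atomProb h a) (tabooTerm (pathLaw h (a, true)) fun p => F p.1) 0 = 0 := by
    simp [cauchyProd]
  rw [h0, mul_zero, add_zero]
  congr 1
  refine Finset.sum_congr rfl fun k hk => ?_
  have hk' : m + 1 - (k + 1) = (m - (k + 1)) + 1 := by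
    have := Finset.mem_range.1 hk
    omega
  have hk'' : m - k = (m - (k + 1)) + 1 := by
    have := Finset.mem_range.1 hk
    omega
  rw [hk', hk'', tabooTerm_mixedPathLaw_succ h measurable_atomInd,
    iterate_stepOp_eq_cauchyProd h hF']

end Regeneration

/-! ### Generating functions -/

section Generating

variable {S : Type*} [MeasurableSpace S] (Q : Measure (ℕ → S × Bool))

/-- On `{T ≥ n + 1}`, the event `Y_{n+1} = 1` means `T = n + 1`; hence `tabooTerm Q (atomInd S)` is
the law of `T` on the finite times. -/
theorem measure_surv_succ (n : ℕ) :
    Q (surv S (n + 1)) = tabooTerm Q (atomInd S) (n + 1) + Q (surv S (n + 2)) := by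
  have hm : MeasurableSet {ω : ℕ → S × Bool | ω (n + 1) ∈ level S true} :=
    measurable_pi_apply (n + 1) (measurableSet_level true)
  rw [← measure_inter_add_sdiff (surv S (n + 1)) hm, tabooTerm_succ, surv_succ (by omega : 1 ≤ n + 1)]
  congr 1
  · have : (fun ω : ℕ → S × Bool => atomInd S (ω (n + 1)))
        = {ω : ℕ → S × Bool | ω (n + 1) ∈ level S true}.indicator 1 := rfl
    rw [this, lintegral_indicator_one hm, Measure.restrict_apply hm, Set.inter_comm]
  · congr 1
    ext ω
    simp [level]

theorem sum_tabooTerm_add_measure_surv [IsProbabilityMeasure Q] (n : ℕ) :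
    ∑ k ∈ Finset.range (n + 1), tabooTerm Q (atomInd S) k + Q (surv S (n + 1)) = 1 := by
  induction n with
  | zero => simp [surv_one]
  | succ n ih =>
    rw [Finset.sum_range_succ, add_assoc, ← measure_surv_succ, ih]

/-- This writes `r ^ T` as a series of indicators of `{T > m}`, ready for termwise integration. At
`T = ⊤` both sides are infinite because `r > 1`. -/
theorem extPow_eq {r : ℝ≥0} (hr : 1 < r) (t : ℕ∞) :
    extPow r t = ((r : ℝ≥0∞) - 1)
      * (∑' m : ℕ, (if ((m + 1 : ℕ) : ℕ∞) ≤ t then 1 else 0) * (r : ℝ≥0∞) ^ m) + 1 := by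
  induction t using ENat.recTopCoe with
  | top =>
    have h1 : ∑' m : ℕ, (r : ℝ≥0∞) ^ m = ⊤ := by
      rw [ENNReal.tsum_geometric, tsub_eq_zero_of_le (by exact_mod_cast hr.le), ENNReal.inv_zero]
    have h2 : ((r : ℝ≥0∞) - 1) ≠ 0 := (tsub_pos_of_lt (by exact_mod_cast hr)).ne'
    have h3 : extPow r ⊤ = if r < 1 then 0 else if r = 1 then 1 else ⊤ := rfl
    simp [h3, h1, ENNReal.mul_top h2, hr.not_gt, hr.ne']
  | coe k =>
    have h3 : extPow r k = (r : ℝ≥0∞) ^ k := rfl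
    rw [tsum_eq_sum (s := Finset.range k), h3, ← sub_one_mul_geom_sum_add_one hr k]
    · refine congrArg (fun s => ((r : ℝ≥0∞) - 1) * s + 1) (Finset.sum_congr rfl fun m hm => ?_)
      rw [if_pos (Nat.cast_le.2 (Finset.mem_range.1 hm)), one_mul]
    · intro m hm
      rw [if_neg, zero_mul]
      rw [Nat.cast_le]
      exact fun h => hm (Finset.mem_range.2 h)

theorem genG_eq [IsProbabilityMeasure Q] {r : ℝ≥0} (hr : 1 < r) :
    genG Q r = ((r : ℝ≥0∞) - 1) * (∑' m : ℕ, Q (surv S (m + 1)) * (r : ℝ≥0∞) ^ m) + 1 := by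
  have hm : ∀ m : ℕ, Measurable fun ω : ℕ → S × Bool =>
      (surv S (m + 1)).indicator (1 : (ℕ → S × Bool) → ℝ≥0∞) ω * (r : ℝ≥0∞) ^ m :=
    fun m => (measurable_one.indicator (measurableSet_surv (m + 1))).mul_const _
  have h1 : ∀ ω : ℕ → S × Bool, extPow r (regTime ω) = ((r : ℝ≥0∞) - 1)
      * (∑' m : ℕ, (surv S (m + 1)).indicator (1 : (ℕ → S × Bool) → ℝ≥0∞) ω * (r : ℝ≥0∞) ^ m)
      + 1 := by
    intro ω
    rw [extPow_eq hr]
    refine congrArg (fun s => ((r : ℝ≥0∞) - 1) * s + 1) (tsum_congr fun m => ?_)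
    by_cases hs : ω ∈ surv S (m + 1)
    · rw [Set.indicator_of_mem hs, if_pos (show ((m + 1 : ℕ) : ℕ∞) ≤ regTime ω from hs)]
      rfl
    · rw [Set.indicator_of_notMem hs, if_neg (show ¬((m + 1 : ℕ) : ℕ∞) ≤ regTime ω from hs)]
  rw [genG, lintegral_congr h1, lintegral_add_right _ measurable_const, lintegral_const_mul _
    (Measurable.tsum hm), lintegral_tsum fun m => (hm m).aemeasurable]
  simp only [lintegral_one, measure_univ]
  congr 2
  refine tsum_congr fun m => ?_
  rw [lintegral_mul_const _ (measurable_one.indicator (measurableSet_surv (m + 1))),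
    lintegral_indicator_one (measurableSet_surv (m + 1))]

/-- Summation by parts leaves a remainder `Q(T > N) r^N ≥ 0`. Only an inequality holds in general,
since paths with `T = ∞` count in `genG` alone. -/
theorem tsum_tabooTerm_atomInd_le_genG [IsProbabilityMeasure Q] {r : ℝ≥0} (hr : 1 < r) :
    ∑' k, tabooTerm Q (atomInd S) k * (r : ℝ≥0∞) ^ k ≤ genG Q r := by
  have h1 : (r : ℝ≥0∞) - 1 + 1 = r := tsub_add_cancel_of_le (by exact_mod_cast hr.le)
  have key : ∀ N, ((r : ℝ≥0∞) - 1) * (∑ m ∈ Finset.range N, Q (surv S (m + 1)) * (r : ℝ≥0∞) ^ m) + 1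
      = ∑ k ∈ Finset.range (N + 1), tabooTerm Q (atomInd S) k * (r : ℝ≥0∞) ^ k
        + Q (surv S (N + 1)) * (r : ℝ≥0∞) ^ N := by
    intro N
    have h2 : ∀ N, (r : ℝ≥0∞) * (r : ℝ≥0∞) ^ N = ((r : ℝ≥0∞) - 1) * (r : ℝ≥0∞) ^ N + (r : ℝ≥0∞) ^ N := by
      intro N
      rw [← add_one_mul, h1]
    induction N with
    | zero => simp [surv_one]
    | succ N ih =>
      rw [Finset.sum_range_succ, mul_add, add_right_comm, ih, Finset.sum_range_succ _ (N + 1),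
        add_assoc, add_assoc, ← add_mul, ← measure_surv_succ, pow_succ', h2]
      ring
  rw [genG_eq Q hr]
  refine ENNReal.tsum_le_of_sum_range_le fun N => ?_
  calc ∑ k ∈ Finset.range N, tabooTerm Q (atomInd S) k * (r : ℝ≥0∞) ^ k
      ≤ ∑ k ∈ Finset.range (N + 1), tabooTerm Q (atomInd S) k * (r : ℝ≥0∞) ^ k
        + Q (surv S (N + 1)) * (r : ℝ≥0∞) ^ N := by
        rw [Finset.sum_range_succ, add_assoc]
        exact le_self_add
    _ ≤ _ := by
        rw [← key]
        gcongr
        exact ENNReal.sum_le_tsum _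

theorem genH_eq {V : S → ℝ≥0} (hV : Measurable V) (r : ℝ≥0) :
    genH Q V r = ∑' n, tabooTerm Q (fun p => (V p.1 : ℝ≥0∞)) n * (r : ℝ≥0∞) ^ n := by
  have hm : ∀ n : ℕ, Measurable fun ω : ℕ → S × Bool => (V (ω n).1 : ℝ≥0∞) := fun n =>
    measurable_coe_nnreal_ennreal.comp (hV.comp (measurable_fst.comp (measurable_pi_apply n)))
  have h1 : ∀ (ω : ℕ → S × Bool) (n : ℕ),
      (if 1 ≤ n ∧ (n : ℕ∞) ≤ regTime ω then (r : ℝ≥0∞) ^ n * (V (ω n).1 : ℝ≥0∞) else 0)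
        = if n = 0 then 0 else
          (surv S n).indicator (fun ω => (V (ω n).1 : ℝ≥0∞) * (r : ℝ≥0∞) ^ n) ω := by
    intro ω n
    rcases Nat.eq_zero_or_pos n with rfl | hn
    · simp
    · rw [if_neg hn.ne']
      by_cases hs : ω ∈ surv S n
      · rw [Set.indicator_of_mem hs, if_pos ⟨hn, hs⟩, mul_comm]
      · rw [Set.indicator_of_notMem hs, if_neg fun h => hs h.2]
  unfold genH
  simp_rw [h1]
  rw [lintegral_tsum]
  · refine tsum_congr fun n => ?_
    cases n with
    | zero => simp
    | succ n =>
      simp only [n.succ_ne_zero, if_false, tabooTerm_succ]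
      rw [lintegral_indicator (measurableSet_surv _), lintegral_mul_const _ (hm _)]
  · intro n
    split_ifs
    · exact aemeasurable_const
    · exact (((hm n).mul_const _).indicator (measurableSet_surv n)).aemeasurable

end Generating

/-! ### Convergence of the chain -/

section Convergence

variable {S : Type*} [MeasurableSpace S] {P : Kernel S S} [IsMarkovKernel P] {π : Measure S}
  [IsProbabilityMeasure π]

instance isMarkovKernel_pow (n : ℕ) : IsMarkovKernel (P ^ n) := by
  induction n with
  | zero =>
    rw [pow_zero]
    exact inferInstanceAs (IsMarkovKernel Kernel.id)
  | succ n ih =>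
    rw [pow_succ]
    exact inferInstanceAs (IsMarkovKernel ((P ^ n) ∘ₖ P))

omit [IsMarkovKernel P] [IsProbabilityMeasure π] in
theorem IsGeometricallyErgodic.tendsto_tvNorm (hπ : IsGeometricallyErgodic P π) (x : S) :
    Tendsto (fun n => tvNorm ((P ^ n) x) π) atTop (𝓝 0) := by
  obtain ⟨γ, h0, h1, h⟩ := hπ.tendsto x
  refine tendsto_of_tendsto_of_tendsto_of_le_of_le tendsto_const_nhds h (fun _ => zero_le)
    fun n => le_mul_of_one_le_left zero_le ?_
  rw [ENNReal.one_le_ofReal]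
  exact (one_le_inv₀ (pow_pos h0 n)).2 (pow_le_one₀ h0.le h1.le)

theorem IsGeometricallyErgodic.tendsto_lintegral_of_le_one (hπ : IsGeometricallyErgodic P π)
    {F : S → ℝ≥0∞} (hF : Measurable F) (h1 : ∀ y, F y ≤ 1) (x : S) :
    Tendsto (fun n => ∫⁻ y, F y ∂(P ^ n) x) atTop (𝓝 (∫⁻ y, F y ∂π)) := by
  have hfin : ∀ y, F y < ⊤ := fun y => (h1 y).trans_lt ENNReal.one_lt_top
  have hle : ∀ μ : Measure S, IsProbabilityMeasure μ → ∫⁻ y, F y ∂μ ≠ ⊤ := fun μ _ =>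
    ne_top_of_le_ne_top ENNReal.one_ne_top ((lintegral_mono h1).trans (by simp))
  have hint : ∀ μ : Measure S, ∫ y, (F y).toReal ∂μ = (∫⁻ y, F y ∂μ).toReal := fun μ =>
    integral_toReal hF.aemeasurable (Eventually.of_forall hfin)
  rw [← ENNReal.tendsto_toReal_iff (fun n => hle _ inferInstance) (hle _ inferInstance),
    tendsto_iff_edist_tendsto_0]
  refine tendsto_of_tendsto_of_tendsto_of_le_of_le tendsto_const_nhds (hπ.tendsto_tvNorm x)
    (fun _ => zero_le) fun n => ?_
  simp only
  rw [edist_eq_enorm_sub, ← hint, ← hint]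
  refine le_iSup_of_le (fun y => (F y).toReal) (le_iSup₂_of_le hF.ennreal_toReal (fun y => ?_) le_rfl)
  rw [abs_of_nonneg ENNReal.toReal_nonneg]
  exact ENNReal.toReal_le_of_le_ofReal zero_le_one (by simpa using h1 y)

theorem IsGeometricallyErgodic.tendsto_lintegral (hπ : IsGeometricallyErgodic P π)
    {F : S → ℝ≥0∞} (hF : Measurable F) {M : ℝ≥0} (hM : ∀ y, F y ≤ M) (x : S) :
    Tendsto (fun n => ∫⁻ y, F y ∂(P ^ n) x) atTop (𝓝 (∫⁻ y, F y ∂π)) := by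
  -- Scaling by `M + 1` rather than `M` keeps the divisor nonzero.
  have h0 : ((M : ℝ≥0∞) + 1) ≠ 0 := by simp
  have ht : ((M : ℝ≥0∞) + 1) ≠ ⊤ := by simp
  have hm : Measurable fun y => F y / ((M : ℝ≥0∞) + 1) := hF.div_const _
  have h1 : ∀ μ : Measure S, ∫⁻ y, F y ∂μ = (M + 1) * ∫⁻ y, F y / ((M : ℝ≥0∞) + 1) ∂μ := by
    intro μ
    rw [← lintegral_const_mul _ hm]
    exact lintegral_congr fun y => (ENNReal.mul_div_cancel h0 ht).symm
  simp_rw [h1]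
  refine ENNReal.Tendsto.const_mul (hπ.tendsto_lintegral_of_le_one hm (fun y => ?_) x) (Or.inr ht)
  exact ENNReal.div_le_of_le_mul (by simpa using (hM y).trans le_self_add)

theorem IsGeometricallyErgodic.tendsto_lintegral_lintegral (hπ : IsGeometricallyErgodic P π)
    (ν : Measure S) [IsProbabilityMeasure ν]
    {F : S → ℝ≥0∞} (hF : Measurable F) {M : ℝ≥0} (hM : ∀ y, F y ≤ M) :
    Tendsto (fun n => ∫⁻ y, ∫⁻ w, F w ∂(P ^ n) y ∂ν) atTop (𝓝 (∫⁻ y, F y ∂π)) := by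
  have h := tendsto_lintegral_of_dominated_convergence (μ := ν) (fun _ => (M : ℝ≥0∞))
    (F := fun n y => ∫⁻ w, F w ∂(P ^ n) y) (f := fun _ => ∫⁻ y, F y ∂π)
    (fun n => hF.lintegral_kernel)
    (fun n => Eventually.of_forall fun y => (lintegral_mono hM).trans (by simp)) (by simp)
    (Eventually.of_forall fun y => hπ.tendsto_lintegral hF hM y)
  simpa using h

end Convergence

/-! ### The renewal theorem and the occupation formula -/

/-- Dominated convergence for the counting measure, with `t` as the dominating function because `u ≤
1`. -/
theorem tendsto_cauchyProd {u t : ℕ → ℝ≥0∞} {U : ℝ≥0∞} (hu1 : ∀ n, u n ≤ 1)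
    (hu : Tendsto u atTop (𝓝 U)) (ht : ∑' n, t n ≠ ⊤) :
    Tendsto (cauchyProd u t) atTop (𝓝 (U * ∑' n, t n)) := by
  have h1 : ∀ n, cauchyProd u t n
      = ∫⁻ k, (if k ≤ n then t k * u (n - k) else 0) ∂(Measure.count : Measure ℕ) := by
    intro n
    rw [lintegral_count, tsum_eq_sum (s := Finset.range (n + 1)), cauchyProd_comm, cauchyProd,
      Finset.Nat.sum_antidiagonal_eq_sum_range_succ (fun i j => t i * u j)]
    · refine Finset.sum_congr rfl fun k hk => ?_
      rw [if_pos (Nat.lt_succ_iff.1 (Finset.mem_range.1 hk))]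
    · intro k hk
      exact if_neg fun h => hk (Finset.mem_range.2 (Nat.lt_succ_iff.2 h))
  have hfin : ∀ k, t k ≠ ⊤ := ENNReal.ne_top_of_tsum_ne_top ht
  have h2 : U * ∑' n, t n = ∫⁻ k, t k * U ∂(Measure.count : Measure ℕ) := by
    rw [lintegral_count, ENNReal.tsum_mul_right, mul_comm]
  rw [h2, tendsto_congr h1]
  refine tendsto_lintegral_of_dominated_convergence t (fun n => measurable_of_countable _)
    (fun n => Eventually.of_forall fun k => ?_) (by rwa [lintegral_count])
    (Eventually.of_forall fun k => ?_)
  · simp only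
    split_ifs
    · exact mul_le_of_le_one_right zero_le (hu1 _)
    · exact zero_le
  · refine Tendsto.congr' ?_ (ENNReal.Tendsto.const_mul (hu.comp (tendsto_sub_atTop_nat k))
      (Or.inr (hfin k)))
    filter_upwards [eventually_ge_atTop k] with n hn
    simp [hn]

section Limit

variable {S : Type*} [MeasurableSpace S] {P : Kernel S S} {C : Set S} {β : ℝ≥0} {ν : Measure S}
  [IsMarkovKernel P] [IsProbabilityMeasure ν] (h : IsMinorized P C β ν) {π : Measure S}
  [IsProbabilityMeasure π]

/-- A visit to the atom at time `n + 1` has probability `∫ P^n (β 1_C) dν`, since the chain leaves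
the atom with law `ν`. -/
theorem tendsto_atomProb (hπ : IsGeometricallyErgodic P π) (a : S) :
    Tendsto (atomProb h a) atTop (𝓝 (∫⁻ y, splitProb C β y ∂π)) := by
  rw [← tendsto_add_atTop_iff_nat 1]
  have h1 : ∀ n, atomProb h a (n + 1) = ∫⁻ y, ∫⁻ w, splitProb C β w ∂(P ^ n) y ∂ν := by
    intro n
    rw [atomProb_eq, iterate_stepOp_succ_true h measurable_atomInd]
    simp_rw [splitOp_atomInd]
  rw [tendsto_congr h1]
  exact hπ.tendsto_lintegral_lintegral ν (measurable_splitProb h) (M := 1)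
    fun y => by simpa using (splitProb_lt_one h y).le

include h in
omit [IsMarkovKernel P] [IsProbabilityMeasure ν] in
theorem lintegral_splitProb_le_one : ∫⁻ y, splitProb C β y ∂π ≤ 1 :=
  (lintegral_mono fun y => (splitProb_lt_one h y).le).trans (by simp)

/-- Expressing the occupation sums as integrals makes monotone convergence in `F` available. -/
theorem exists_occupation_measure (Q : Measure (ℕ → S × Bool)) :
    ∃ m : Measure S, ∀ F : S → ℝ≥0∞, Measurable F →
      ∑' n, tabooTerm Q (fun p => F p.1) n = ∫⁻ y, F y ∂m := by
  refine ⟨Measure.sum fun n => (Q.restrict (surv S (n + 1))).map fun ω => (ω (n + 1)).1,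
    fun F hF => ?_⟩
  rw [lintegral_sum_measure, tsum_eq_zero_add' ENNReal.summable, tabooTerm_zero, zero_add]
  refine tsum_congr fun n => ?_
  have hm : Measurable fun ω : ℕ → S × Bool => (ω (n + 1)).1 :=
    measurable_fst.comp (measurable_pi_apply _)
  rw [tabooTerm_succ, lintegral_map hF hm]

/-- Both sides are limits of `∫ P^n F dν`: one by ergodicity, which requires `F` bounded, the other
by the last-exit decomposition and `u_n → v`. -/
theorem lintegral_eq_of_le (hπ : IsGeometricallyErgodic P π) (a : S) {F : S → ℝ≥0∞}
    (hF : Measurable F) {M : ℝ≥0} (hM : ∀ y, F y ≤ M)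
    (hfin : ∑' n, tabooTerm (pathLaw h (a, true)) (fun p => F p.1) n ≠ ⊤) :
    ∫⁻ y, F y ∂π = (∫⁻ y, splitProb C β y ∂π)
      * ∑' n, tabooTerm (pathLaw h (a, true)) (fun p => F p.1) n := by
  refine tendsto_nhds_unique ?_ ((tendsto_add_atTop_iff_nat 1).2
    (tendsto_cauchyProd (atomProb_le_one h a) (tendsto_atomProb h hπ a) hfin))
  refine (hπ.tendsto_lintegral_lintegral ν hF hM).congr fun n => ?_
  have hF' : Measurable fun p : S × Bool => F p.1 := hF.comp measurable_fst
  rw [← iterate_stepOp_eq_cauchyProd h hF', iterate_stepOp_succ_true h hF']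
  simp_rw [splitOp_fst h]

/-- Kac's occupation formula for the invariant law. -/
theorem lintegral_invariant_eq (hπ : IsGeometricallyErgodic P π) (a : S) {F : S → ℝ≥0∞}
    (hF : Measurable F)
    (hfin : ∑' n, tabooTerm (pathLaw h (a, true)) (fun p => F p.1) n ≠ ⊤) :
    ∫⁻ y, F y ∂π = (∫⁻ y, splitProb C β y ∂π)
      * ∑' n, tabooTerm (pathLaw h (a, true)) (fun p => F p.1) n := by
  obtain ⟨m, hm⟩ := exists_occupation_measure (pathLaw h (a, true))
  have hmeas : ∀ M : ℕ, Measurable fun y => min (F y) M := fun M => hF.min measurable_const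
  have hmono : Monotone fun (M : ℕ) y => min (F y) M := fun M N hMN y =>
    min_le_min le_rfl (by exact_mod_cast hMN)
  have hsup : ∀ μ : Measure S, ∫⁻ y, F y ∂μ = ⨆ M : ℕ, ∫⁻ y, min (F y) M ∂μ := by
    intro μ
    rw [← lintegral_iSup hmeas hmono]
    refine lintegral_congr fun y => ?_
    rw [← inf_iSup_eq, ENNReal.iSup_natCast, inf_top_eq]
  -- The bounded case is applied to the truncations `min F M`, and both sides increase to their
  -- values at `F`.
  rw [hm F hF] at hfin ⊢
  rw [hsup m, hsup π, ENNReal.mul_iSup]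
  refine iSup_congr fun M => ?_
  rw [← hm _ (hmeas M)]
  refine lintegral_eq_of_le h hπ a (hmeas M) (M := M) (fun y => by simp) ?_
  rw [hm _ (hmeas M)]
  exact ne_top_of_le_ne_top hfin (lintegral_mono fun y => min_le_left _ _)

end Limit

/-! ### The bound -/

section Bound

theorem toReal_cauchyProd {a b : ℕ → ℝ≥0∞} (ha : ∀ n, a n ≠ ⊤) (hb : ∀ n, b n ≠ ⊤) (n : ℕ) :
    (cauchyProd a b n).toReal = cauchyProd (fun k => (a k).toReal) (fun k => (b k).toReal) n := by
  rw [cauchyProd, ENNReal.toReal_sum fun _ _ => ENNReal.mul_ne_top (ha _) (hb _)]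
  simp [cauchyProd, ENNReal.toReal_mul]

theorem cauchyProd_ne_top {a b : ℕ → ℝ≥0∞} (ha : ∀ n, a n ≠ ⊤) (hb : ∀ n, b n ≠ ⊤) (n : ℕ) :
    cauchyProd a b n ≠ ⊤ :=
  ENNReal.sum_ne_top.2 fun _ _ => ENNReal.mul_ne_top (ha _) (hb _)

theorem cauchyProd_sub (a b c : ℕ → ℝ) (n : ℕ) :
    cauchyProd a (fun k => b k - c k) n = cauchyProd a b n - cauchyProd a c n := by
  simp [cauchyProd, mul_sub]

theorem enorm_toReal_sub_toReal_le (x y : ℝ≥0∞) : ‖x.toReal - y.toReal‖ₑ ≤ x + y := by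
  refine (enorm_sub_le).trans (add_le_add ?_ ?_) <;>
  · rw [Real.enorm_eq_ofReal ENNReal.toReal_nonneg]
    exact ENNReal.ofReal_toReal_le

variable {S : Type*} [MeasurableSpace S]

theorem tabooTerm_mono (Q : Measure (ℕ → S × Bool)) {F G : S × Bool → ℝ≥0∞} (hFG : ∀ p, F p ≤ G p)
    (n : ℕ) : tabooTerm Q F n ≤ tabooTerm Q G n := by
  cases n with
  | zero => simp
  | succ n =>
    rw [tabooTerm_succ, tabooTerm_succ]
    exact lintegral_mono fun ω => hFG _

theorem tabooTerm_add (Q : Measure (ℕ → S × Bool)) {F G : S × Bool → ℝ≥0∞} (hF : Measurable F)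
    (n : ℕ) : tabooTerm Q F n + tabooTerm Q G n = tabooTerm Q (fun p => F p + G p) n := by
  cases n with
  | zero => simp
  | succ n =>
    rw [tabooTerm_succ, tabooTerm_succ, tabooTerm_succ]
    exact (lintegral_add_left (hF.comp (measurable_pi_apply _)) _).symm

theorem ne_top_of_tsum_mul_pow_ne_top {τ : ℕ → ℝ≥0∞} {r : ℝ≥0} (hr : 1 < r)
    (hτ : ∑' n, τ n * (r : ℝ≥0∞) ^ n ≠ ⊤) : ∑' n, τ n ≠ ⊤ :=
  ne_top_of_le_ne_top hτ <| ENNReal.tsum_le_tsum fun _ =>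
    le_mul_of_one_le_right zero_le (one_le_pow₀ (by exact_mod_cast hr.le))

variable {P : Kernel S S} {C : Set S} {β : ℝ≥0} {ν : Measure S}
  [IsMarkovKernel P] [IsProbabilityMeasure ν] (h : IsMinorized P C β ν) {π : Measure S}
  [IsProbabilityMeasure π]

theorem tabooTerm_atomInd_ne_top (Q : Measure (ℕ → S × Bool)) [IsProbabilityMeasure Q] (n : ℕ) :
    tabooTerm Q (atomInd S) n ≠ ⊤ := by
  refine ne_top_of_le_ne_top ENNReal.one_ne_top ?_
  rw [← sum_tabooTerm_add_measure_surv Q n, Finset.sum_range_succ, add_assoc]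
  exact le_add_left le_self_add

theorem atomProb_ne_top (a : S) (n : ℕ) : atomProb h a n ≠ ⊤ :=
  ne_top_of_le_ne_top ENNReal.one_ne_top (atomProb_le_one h a n)

theorem lintegral_kernel_pow_ne_top {F : S → ℝ≥0∞} (hF : Measurable F) (a x : S)
    (hfx : ∀ n, tabooTerm (mixedPathLaw h x) (fun p => F p.1) n ≠ ⊤)
    (hfa : ∑' n, tabooTerm (pathLaw h (a, true)) (fun p => F p.1) n ≠ ⊤) {n : ℕ} (hn : 1 ≤ n) :
    ∫⁻ y, F y ∂(P ^ n) x ≠ ⊤ := by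
  rw [lintegral_kernel_pow_eq h hF a x hn]
  exact ENNReal.add_ne_top.2 ⟨hfx n, cauchyProd_ne_top (tabooTerm_atomInd_ne_top _)
    (cauchyProd_ne_top (atomProb_ne_top h a) (ENNReal.ne_top_of_tsum_ne_top hfa)) n⟩

/-- The regeneration decomposition of `P ^ n F - π(F)`, in real numbers. -/
theorem toReal_lintegral_kernel_pow_sub (hπ : IsGeometricallyErgodic P π) {F : S → ℝ≥0∞}
    (hF : Measurable F) (a x : S)
    (hfx : ∀ n, tabooTerm (mixedPathLaw h x) (fun p => F p.1) n ≠ ⊤)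
    (hfa : ∑' n, tabooTerm (pathLaw h (a, true)) (fun p => F p.1) n ≠ ⊤) {n : ℕ} (hn : 1 ≤ n) :
    (∫⁻ y, F y ∂(P ^ n) x).toReal - (∫⁻ y, F y ∂π).toReal
      = (tabooTerm (mixedPathLaw h x) (fun p => F p.1) n).toReal
        + cauchyProd (fun k => (tabooTerm (mixedPathLaw h x) (atomInd S) k).toReal)
          (cauchyProd (renewalSeq h a)
            fun k => (tabooTerm (pathLaw h (a, true)) (fun p => F p.1) k).toReal) n
        - (∫⁻ y, splitProb C β y ∂π).toReal
          * ∑' k, (tabooTerm (pathLaw h (a, true)) (fun p => F p.1) k).toReal := by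
  have hta := ENNReal.ne_top_of_tsum_ne_top hfa
  have hu := atomProb_ne_top h a
  have hut := cauchyProd_ne_top hu hta
  have h1 : (fun k => (cauchyProd (atomProb h a)
      (tabooTerm (pathLaw h (a, true)) fun p => F p.1) k).toReal)
      = cauchyProd (renewalSeq h a)
        fun k => (tabooTerm (pathLaw h (a, true)) (fun p => F p.1) k).toReal := by
    ext k
    rw [toReal_cauchyProd hu hta]
    simp_rw [toReal_atomProb]
  rw [lintegral_kernel_pow_eq h hF a x hn, lintegral_invariant_eq h hπ a hF hfa,
    ENNReal.toReal_add (hfx n) (cauchyProd_ne_top (tabooTerm_atomInd_ne_top _) hut n),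
    toReal_cauchyProd (tabooTerm_atomInd_ne_top _) hut, ENNReal.toReal_mul,
    ENNReal.tsum_toReal_eq hta, h1]

/-- The bound in closed form: the difference quotients of generating functions are those of tails. -/
theorem regenBound_eq (Qx Qa : Measure (ℕ → S × Bool)) [IsProbabilityMeasure Qx] {V : S → ℝ≥0}
    (hV : Measurable V) (d : ℕ → ℝ) {r : ℝ≥0} (hr : 1 < r) (hH : genH Qa V r ≠ ⊤) :
    regenBound Qx Qa V d r = genH Qx V r + genG Qx r * genH Qa V r * supSeries 0 d r
      + genH Qa V r * (∑' m : ℕ, Qx (surv S (m + 1)) * (r : ℝ≥0∞) ^ m)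
      + ∑' n, (if 1 ≤ n then ∑' j, if n < j then
          tabooTerm Qa (fun p => (V p.1 : ℝ≥0∞)) j else 0 else 0) * (r : ℝ≥0∞) ^ n := by
  have h0 : (r : ℝ≥0∞) - 1 ≠ 0 := (tsub_pos_of_lt (by exact_mod_cast hr)).ne'
  have ht : (r : ℝ≥0∞) - 1 ≠ ⊤ := ENNReal.sub_ne_top ENNReal.coe_ne_top
  have hH1 : (r : ℝ≥0∞) * genH Qa V 1 ≠ ⊤ := by
    refine ENNReal.mul_ne_top ENNReal.coe_ne_top ?_
    rw [genH_eq Qa hV] at hH ⊢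
    simpa using ne_top_of_tsum_mul_pow_ne_top hr hH
  unfold regenBound
  congr 1
  · congr 2
    rw [genG_eq Qx hr, ENNReal.add_sub_cancel_right ENNReal.one_ne_top,
      mul_div_assoc, ENNReal.mul_div_cancel h0 ht]
  · have h1 := sub_one_mul_tsum_tail_add hr (tabooTerm_zero Qa fun p => (V p.1 : ℝ≥0∞))
    rw [← genH_eq Qa hV, show ∑' j, tabooTerm Qa (fun p => (V p.1 : ℝ≥0∞)) j = genH Qa V 1 by
      simp [genH_eq Qa hV]] at h1
    rw [← h1, ENNReal.add_sub_cancel_right hH1, mul_div_assoc, ENNReal.mul_div_cancel h0 ht]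

/-- The third summand of the bound is `H · B` with `B = ∑ Q(T > m) r^m ≥ 1`, the term `m = 0` being
`1`. Hence `H` is finite, and so is `G · H = (r - 1) H · B + H`, even when `G = ∞` and `H = 0`. -/
theorem genH_ne_top_of_regenBound_lt_top (Qx Qa : Measure (ℕ → S × Bool)) [IsProbabilityMeasure Qx]
    {V : S → ℝ≥0} {d : ℕ → ℝ} {r : ℝ≥0} (hr : 1 < r) (hb : regenBound Qx Qa V d r < ⊤) :
    genH Qa V r ≠ ⊤ ∧ genG Qx r * genH Qa V r ≠ ⊤ := by
  have h0 : (r : ℝ≥0∞) - 1 ≠ 0 := (tsub_pos_of_lt (by exact_mod_cast hr)).ne'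
  have ht : (r : ℝ≥0∞) - 1 ≠ ⊤ := ENNReal.sub_ne_top ENNReal.coe_ne_top
  have h3 : genH Qa V r * ((genG Qx r - 1) / ((r : ℝ≥0∞) - 1)) ≠ ⊤ :=
    ne_top_of_le_ne_top hb.ne (le_add_right le_add_self)
  rw [genG_eq Qx hr, ENNReal.add_sub_cancel_right ENNReal.one_ne_top,
    mul_div_assoc, ENNReal.mul_div_cancel h0 ht] at h3
  have hB : 1 ≤ ∑' m : ℕ, Qx (surv S (m + 1)) * (r : ℝ≥0∞) ^ m := by
    refine le_trans ?_ (ENNReal.le_tsum 0)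
    simp [surv_one]
  have hH : genH Qa V r ≠ ⊤ := ne_top_of_le_ne_top h3 (le_mul_of_one_le_right zero_le hB)
  refine ⟨hH, ?_⟩
  rw [genG_eq Qx hr, add_mul, one_mul, mul_assoc, mul_comm (∑' m : ℕ, _)]
  exact ENNReal.add_ne_top.2 ⟨ENNReal.mul_ne_top ht h3, hH⟩

end Bound

end SplitChain

/-! ### ### The theorem for signed functions -/

open SplitChain in
theorem proposition4p3 {S : Type*} [MeasurableSpace S]
    (P : Kernel S S) [IsMarkovKernel P]
    (C : Set S) (β : ℝ≥0) (ν : Measure S) [IsProbabilityMeasure ν]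
    (h : SplitChain.IsMinorized P C β ν)
    (π : Measure S) [IsProbabilityMeasure π]
    (hπ : SplitChain.IsGeometricallyErgodic P π)
    (V : S → ℝ≥0) (hV : Measurable V)
    (a : S) (ha : a ∈ C) :
    ∃ uinf : ℝ, Tendsto (SplitChain.renewalSeq h a) atTop (𝓝 uinf) ∧
      ∀ g : S → ℝ, Measurable g → (∀ y, |g y| ≤ V y) →
        ∀ (x : S) (r : ℝ≥0), 1 < r →
          SplitChain.regenBound (SplitChain.mixedPathLaw h x) (SplitChain.pathLaw h (a, true)) V
              (fun n => SplitChain.renewalSeq h a n - uinf) r < ⊤ →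
            Integrable g π ∧ (∀ n : ℕ, Integrable g ((P ^ n) x)) ∧
              SplitChain.supSeries 1 (fun n => ∫ y, g y ∂((P ^ n) x) - ∫ y, g y ∂π) r
                ≤ SplitChain.regenBound (SplitChain.mixedPathLaw h x)
                    (SplitChain.pathLaw h (a, true)) V
                    (fun n => SplitChain.renewalSeq h a n - uinf) r := by
  have hU1 := lintegral_splitProb_le_one h (π := π)
  have hUt : ∫⁻ y, splitProb C β y ∂π ≠ ⊤ := ne_top_of_le_ne_top ENNReal.one_ne_top hU1
  refine ⟨(∫⁻ y, splitProb C β y ∂π).toReal, ?_, fun g hg hgV x r hr hb => ?_⟩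
  · exact ((ENNReal.tendsto_toReal hUt).comp (tendsto_atomProb h hπ a)).congr
      fun n => toReal_atomProb h a n
  obtain ⟨hHa, hGH⟩ := genH_ne_top_of_regenBound_lt_top _ _ hr hb
  have hHx : genH (mixedPathLaw h x) V r ≠ ⊤ :=
    ne_top_of_le_ne_top hb.ne (le_add_right (le_add_right le_self_add))
  rw [regenBound_eq _ _ hV _ hr hHa]
  rw [genH_eq _ hV] at hHx hHa hGH ⊢
  rw [genH_eq _ hV]
  have hVm : Measurable fun y => (V y : ℝ≥0∞) := measurable_coe_nnreal_ennreal.comp hV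
  have hsa := ne_top_of_tsum_mul_pow_ne_top hr hHa
  have hsx := ENNReal.ne_top_of_tsum_ne_top (ne_top_of_tsum_mul_pow_ne_top hr hHx)
  have hgV' : ∀ y, ‖g y‖ₑ ≤ V y := fun y => by
    rw [Real.enorm_eq_ofReal_abs, ENNReal.ofReal_le_iff_le_toReal ENNReal.coe_ne_top]
    exact hgV y
  have hint : ∀ μ : Measure S, ∫⁻ y, (V y : ℝ≥0∞) ∂μ ≠ ⊤ → Integrable g μ := fun μ hμ =>
    ⟨hg.aestronglyMeasurable, (lintegral_mono hgV').trans_lt hμ.lt_top⟩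
  have hintπ : Integrable g π := by
    refine hint π ?_
    rw [lintegral_invariant_eq h hπ a hVm hsa]
    exact ENNReal.mul_ne_top hUt hsa
  have hintP : ∀ n : ℕ, Integrable g ((P ^ n) x) := by
    intro n
    refine hint _ ?_
    rcases Nat.eq_zero_or_pos n with rfl | hn
    · rw [pow_zero]
      change ∫⁻ y, (V y : ℝ≥0∞) ∂Kernel.id x ≠ ⊤
      rw [Kernel.id_apply, lintegral_dirac' _ hVm]
      exact ENNReal.coe_ne_top
    · exact lintegral_kernel_pow_ne_top h hVm a x hsx hsa hn
  refine ⟨hintπ, hintP, ?_⟩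
  have hgp : Measurable fun y => ENNReal.ofReal (g y) := hg.ennreal_ofReal
  have hgm : Measurable fun y => ENNReal.ofReal (-g y) := hg.neg.ennreal_ofReal
  -- The two parts add up to `|g|`, so treating them together costs no factor `2` against `V`.
  have hsum : ∀ y, ENNReal.ofReal (g y) + ENNReal.ofReal (-g y) ≤ V y := fun y => by
    refine le_trans (le_of_eq ?_) (hgV' y)
    rw [Real.enorm_eq_ofReal_abs]
    rcases le_total 0 (g y) with h0 | h0
    · rw [abs_of_nonneg h0, ENNReal.ofReal_of_nonpos (neg_nonpos.2 h0), add_zero]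
    · rw [abs_of_nonpos h0, ENNReal.ofReal_of_nonpos h0, zero_add]
  have htab : ∀ (Q : Measure (ℕ → S × Bool)) (n : ℕ),
      tabooTerm Q (fun p => ENNReal.ofReal (g p.1)) n
        + tabooTerm Q (fun p => ENNReal.ofReal (-g p.1)) n
        ≤ tabooTerm Q (fun p => (V p.1 : ℝ≥0∞)) n := fun Q n => by
    have hgp' : Measurable fun p : S × Bool => ENNReal.ofReal (g p.1) := hgp.comp measurable_fst
    rw [tabooTerm_add Q hgp']
    exact tabooTerm_mono Q (fun p => hsum p.1) n
  have hpx := fun n => ne_top_of_le_ne_top (hsx n) (le_self_add.trans (htab (mixedPathLaw h x) n))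
  have hmx := fun n => ne_top_of_le_ne_top (hsx n) (le_add_self.trans (htab (mixedPathLaw h x) n))
  have hpa := ne_top_of_le_ne_top hsa (ENNReal.tsum_le_tsum fun n =>
    le_self_add.trans (htab (pathLaw h (a, true)) n))
  have hma := ne_top_of_le_ne_top hsa (ENNReal.tsum_le_tsum fun n =>
    le_add_self.trans (htab (pathLaw h (a, true)) n))
  have hG := tsum_tabooTerm_atomInd_le_genG (mixedPathLaw h x) hr
  refine (supSeries_renewal_le (u := renewalSeq h a)
    (f := fun n => (tabooTerm (mixedPathLaw h x) (fun p => ENNReal.ofReal (g p.1)) n).toReal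
      - (tabooTerm (mixedPathLaw h x) (fun p => ENNReal.ofReal (-g p.1)) n).toReal)
    (t := fun n => (tabooTerm (pathLaw h (a, true)) (fun p => ENNReal.ofReal (g p.1)) n).toReal
      - (tabooTerm (pathLaw h (a, true)) (fun p => ENNReal.ofReal (-g p.1)) n).toReal)
    (a := fun n => (tabooTerm (mixedPathLaw h x) (atomInd S) n).toReal)
    (b := fun n => (mixedPathLaw h x (surv S (n + 1))).toReal)
    (v := (∫⁻ y, splitProb C β y ∂π).toReal) hr
    (fun n => (enorm_toReal_sub_toReal_le _ _).trans (htab _ n))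
    (fun n => (enorm_toReal_sub_toReal_le _ _).trans (htab _ n))
    (α := tabooTerm (mixedPathLaw h x) (atomInd S)) (β := fun n => mixedPathLaw h x (surv S (n + 1)))
    (fun n => ?_) (fun n => ?_) (by simp) (by simp) (fun n => ?_) ENNReal.toReal_nonneg ?_
    (fun n hn => ?_) hHa ?_).trans ?_
  · simpa using enorm_toReal_sub_toReal_le (tabooTerm (mixedPathLaw h x) (atomInd S) n) 0
  · simp
  · rw [← ENNReal.toReal_sum fun k _ => tabooTerm_atomInd_ne_top _ k,
      ← ENNReal.toReal_add (ENNReal.sum_ne_top.2 fun k _ => tabooTerm_atomInd_ne_top _ k)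
        (measure_ne_top _ _), sum_tabooTerm_add_measure_surv, ENNReal.toReal_one]
  · exact ENNReal.toReal_le_of_le_ofReal zero_le_one (by simpa using hU1)
  -- Convolution is linear: the decomposition for `g` is the difference of those for its positive
  -- and negative parts.
  · have hp := toReal_lintegral_kernel_pow_sub h hπ hgp a x hpx hpa hn
    have hm := toReal_lintegral_kernel_pow_sub h hπ hgm a x hmx hma hn
    have hcc : cauchyProd (renewalSeq h a) (fun k =>
        (tabooTerm (pathLaw h (a, true)) (fun p => ENNReal.ofReal (g p.1)) k).toReal
        - (tabooTerm (pathLaw h (a, true)) (fun p => ENNReal.ofReal (-g p.1)) k).toReal)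
        = fun n => cauchyProd (renewalSeq h a) (fun k =>
          (tabooTerm (pathLaw h (a, true)) (fun p => ENNReal.ofReal (g p.1)) k).toReal) n
          - cauchyProd (renewalSeq h a) (fun k =>
          (tabooTerm (pathLaw h (a, true)) (fun p => ENNReal.ofReal (-g p.1)) k).toReal) n :=
      funext fun k => cauchyProd_sub _ _ _ k
    rw [integral_eq_lintegral_pos_part_sub_lintegral_neg_part (hintP n),
      integral_eq_lintegral_pos_part_sub_lintegral_neg_part hintπ, hcc, cauchyProd_sub,
      (ENNReal.summable_toReal hpa).tsum_sub (ENNReal.summable_toReal hma)]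
    linear_combination hp - hm
  · exact ne_top_of_le_ne_top hGH (by gcongr)
  · gcongr
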